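/- **Setting.** For $\sigma\in\mathbb R$ let $\Pi_\sigma=\{s\in\mathbb C:\operatorname{Re}s>\sigma\}$, and let $H^2(\Pi_\sigma)$ be the space of analytic $f:\Pi_\sigma\to\mathbb C$ with $$\|f\|_2=\sup_{x>\sigma}\Big(\int_{-\infty}^{\infty}|f(x+it)|^2\,dt\Big)^{1/2}<\infty .$$ Let $L(s)=\sum_{n\ge1}a_nn^{-s}$ be a Dirichlet series with $a_n=O_\varepsilon(n^\varepsilon)$ for every $\varepsilon>0$. Let $\sigma_0<1$ and $m_L\ge1$ be such that $L$ has a meromorphic continuation to $\Pi_{\sigma_0}$ whose only pole is at $s=1$, of order $m_L$, and such that $(s-1)^{m_L}L(s)$ is analytic of finite order in $\Pi_{\sigma_0}$, i.e. it is $O(\exp(|s|^{\rho}))$ for some $\rho$ as $|s|\to\infty$ in $\Pi_{\sigma_0}$. Let $\varphi:[0,\infty)\to\mathbb C$ be measurable, supported on $[0,1]$ and locally bounded on $(0,1)$, with $\varphi(x)=O(x^{-\sigma_0})$ as $x\to0^+$ and $\varphi(x)=O((1-x)^{-\sigma_1})$ as $x\to1^-$ for some $\sigma_1<1/2$. Put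 $\widehat\varphi(s)=\int_0^\infty\varphi(t)t^{s-1}\,dt$ for $s\in\Pi_{\sigma_0}$ and $$\psi(u)=\operatorname{Res}_{s=1}\big(L(s)\widehat\varphi(s)u^s\big)-\sum_{1\le n<u}a_n\varphi(n/u)\qquad(u>0).$$ Assume that $r_0$ satisfies $\sigma_0<r_0<1$ and $\int_1^\infty|\psi(t)|^2t^{-1-2r_0}\,dt<\infty$. Let $\mathcal S=\bigcup_{\ell\ge1}(0,1]^\ell\times\mathbb C^\ell$. For $A=(\alpha,c)\in\mathcal S$ of length $\ell$ and $r_0\le r<1$ put $g_A(s)=\sum_{j=1}^{\ell}c_j\alpha_j^s$, $b_{1,r}(s)=\dfrac{s-1}{s+1-2r}$ and $$h_{A,r}(s)=-\frac1{\sqrt{2\pi}}\,L(s+r-\sigma_0)\,\widehat\varphi(s+r-\sigma_0)\,g_A(s+r-\sigma_0)\,b_{1,r}(s+r-\sigma_0)^{m_L}\qquad(s\in\Pi_{\sigma_0}),$$ where the removable singularity at $s=1-r+\sigma_0$ is filled in by continuity. **Proposition.** Let $r_0\le r<1$, $\lambda\in\Pi_{\sigma_0}$ and $A\in\mathcal S$.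 Then $h_{A,r}\in H^2(\Pi_{\sigma_0})$, and the set $$r-\sigma_0+\left\{\mu\in\mathbb C:\ \mu+\overline\lambda-2\sigma_0\ne0,\ \left|\frac{\mu-\lambda}{\mu+\overline\lambda-2\sigma_0}\right|<\sqrt{4\pi(\operatorname{Re}\lambda-\sigma_0)}\,\frac{|h_{A,r}(\lambda)|}{\|h_{A,r}\|_2}\right\}$$ is contained in $\Pi_{\sigma_0}$ and contains no zero of $L$. (If $h_{A,r}$ vanishes identically, the quotient $|h_{A,r}(\lambda)|/\|h_{A,r}\|_2$ is read as $0$ and the set is empty.) -/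

import Mathlib

open Filter Topology MeasureTheory Complex

open scoped ENNReal ComplexConjugate

noncomputable section

namespace ZeroFree

/-- The open half-plane `Π_σ` of all `s` with `Re s > σ`. -/
def halfPlane (σ : ℝ) : Set ℂ := {s | σ < s.re}

/-- The residue of `f` at `z₀`: the limit of `(2πi)⁻¹ ∮_{|z - z₀| = ρ} f(z) dz` as `ρ → 0⁺`
(for `f` meromorphic at `z₀` the integral does not depend on `ρ` once `ρ` is small). -/
def residue (f : ℂ → ℂ) (z₀ : ℂ) : ℂ :=
  limUnder (𝓝[>] (0 : ℝ)) fun ρ => (2 * (Real.pi : ℂ) * I)⁻¹ * ∮ z in C(z₀, ρ), f z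

/-- `L` is a meromorphic continuation of the Dirichlet series `∑_{n ≥ 1} a n / n ^ s` to
`Re s > σ₀`, with a unique pole, of order `m`, at `s = 1`. The value `L 1` is irrelevant. -/
structure IsDirichletContinuation (a : ℕ → ℂ) (L : ℂ → ℂ) (σ₀ : ℝ) (m : ℕ) : Prop where
  coeff_isBigO : ∀ ε : ℝ, 0 < ε → a =O[atTop] fun n : ℕ => (n : ℝ) ^ ε
  sigma_lt_one : σ₀ < 1
  eq_LSeries : ∀ s : ℂ, 1 < s.re → L s = LSeries a s
  analytic : AnalyticOnNhd ℂ L (halfPlane σ₀ \ {1})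
  meromorphicAt_one : MeromorphicAt L 1
  pole_pos : 1 ≤ m
  pole_order : meromorphicOrderAt L 1 = ((-(m : ℤ) : ℤ) : WithTop ℤ)
  /-- `(s - 1) ^ m * L s` has finite order in the half-plane. -/
  finite_order : ∃ ρ : ℝ,
    (fun s : ℂ => (s - 1) ^ m * L s)
      =O[Bornology.cobounded ℂ ⊓ 𝓟 (halfPlane σ₀)] fun s : ℂ => Real.exp (‖s‖ ^ ρ)

/-- The conditions on the weight `φ : [0, ∞) → ℂ`, here extended by `0` to the real line. -/
structure IsWeight (φ : ℝ → ℂ) (σ₀ : ℝ) : Prop where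
  measurable : AEMeasurable φ volume
  support_subset : Function.support φ ⊆ Set.Icc 0 1
  locally_bounded : ∀ K : Set ℝ, IsCompact K → K ⊆ Set.Ioo 0 1 → ∃ C : ℝ, ∀ x ∈ K, ‖φ x‖ ≤ C
  isBigO_zero : φ =O[𝓝[>] 0] fun x : ℝ => x ^ (-σ₀)
  isBigO_one : ∃ σ₁ : ℝ, σ₁ < 1 / 2 ∧ φ =O[𝓝[<] 1] fun x : ℝ => (1 - x) ^ (-σ₁)

/-- `ψ(u) = res(L(s) φ̂(s) u ^ s, s = 1) - ∑_{n < u} a n φ(n / u)` for `u > 0`,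
the sum being over integers `n ≥ 1`; `mellin φ` is the Mellin transform `φ̂`. -/
def psi (a : ℕ → ℂ) (L : ℂ → ℂ) (φ : ℝ → ℂ) (u : ℝ) : ℂ :=
  residue (fun s => L s * mellin φ s * (u : ℂ) ^ s) 1
    - ∑ n ∈ Finset.Ico 1 ⌈u⌉₊, a n * φ (n / u)

/-- The condition `r < 1` and `∫_1^∞ |ψ(t)|² dt / t ^ (1 + 2 r) < ∞`. -/
def PsiCondition (a : ℕ → ℂ) (L : ℂ → ℂ) (φ : ℝ → ℂ) (r : ℝ) : Prop :=
  r < 1 ∧ IntegrableOn (fun t : ℝ => ‖psi a L φ t‖ ^ 2 / t ^ (1 + 2 * r)) (Set.Ioi 1) volume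

/-- The set `𝒮`, the union over `ℓ ≥ 1` of `(0, 1] ^ ℓ × ℂ ^ ℓ`. -/
structure Seq where
  len : ℕ
  len_pos : 1 ≤ len
  α : Fin len → ℝ
  α_mem : ∀ j, α j ∈ Set.Ioc (0 : ℝ) 1
  c : Fin len → ℂ

/-- `g_A(s) = ∑_j c_j α_j ^ s`. -/
def Seq.g (A : Seq) (s : ℂ) : ℂ := ∑ j, A.c j * (A.α j : ℂ) ^ s

/-- The elementary Blaschke factor `b_{λ,r}(s) = (s - λ) / (s + conj λ - 2 r)` of `Π_r`. -/
def blaschke (lam : ℂ) (r : ℝ) (s : ℂ) : ℂ := (s - lam) / (s + conj lam - 2 * r)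

/-- The formula for `h_{A,r}`, meaningful away from the point where `s + r - σ₀ = 1`. -/
def hFormula (L : ℂ → ℂ) (φ : ℝ → ℂ) (σ₀ : ℝ) (m : ℕ) (A : Seq) (r : ℝ) (s : ℂ) : ℂ :=
  -(1 / (Real.sqrt (2 * Real.pi) : ℂ)) * L (s + r - σ₀) * mellin φ (s + r - σ₀)
    * A.g (s + r - σ₀) * blaschke 1 r (s + r - σ₀) ^ m

/-- `h_{A,r}`: the removable singularity at `s = 1 - r + σ₀`, where the zero of order `m` of the
power of the Blaschke factor compensates the pole of `L`, is filled in by its limit. -/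
def h (L : ℂ → ℂ) (φ : ℝ → ℂ) (σ₀ : ℝ) (m : ℕ) (A : Seq) (r : ℝ) : ℂ → ℂ :=
  Function.update (hFormula L φ σ₀ m A r) (1 - r + σ₀)
    (limUnder (𝓝[≠] (1 - r + σ₀ : ℂ)) (hFormula L φ σ₀ m A r))

/-- The extended norm `sup_{x > σ} (∫ |f(x + i t)|² dt)^{1/2}` in `[0, ∞]`. -/
def hardyENorm (σ : ℝ) (f : ℂ → ℂ) : ℝ≥0∞ :=
  ⨆ (x : ℝ) (_ : σ < x), (∫⁻ t : ℝ, ‖f (x + t * I)‖ₑ ^ 2) ^ (1 / 2 : ℝ)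

/-- Membership in the Hardy space `H²(Π_σ)`. -/
def MemHardy (σ : ℝ) (f : ℂ → ℂ) : Prop :=
  AnalyticOnNhd ℂ f (halfPlane σ) ∧ hardyENorm σ f < ∞

/-- The norm of `H²(Π_σ)`. -/
def hardyNorm (σ : ℝ) (f : ℂ → ℂ) : ℝ := (hardyENorm σ f).toReal

/-- The set of all `μ` with `|(μ - λ) / (μ + conj λ - 2 σ₀)| < R`; the point at which the
denominator vanishes does not belong to it. -/
def disc (σ₀ : ℝ) (lam : ℂ) (R : ℝ) : Set ℂ :=
  {μ | μ + conj lam - 2 * σ₀ ≠ 0 ∧ ‖(μ - lam) / (μ + conj lam - 2 * σ₀)‖ < R}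

end ZeroFree

end

/-!
In the logarithmic variable `v = log u`, the function `Ψ(v) = ψ(e ^ v)`, cut off to `v > 0`, is the
residue term minus the Dirichlet sum. For `Re s > 1` the Laplace transform of the Dirichlet sum is
`L(s) φ̂(s)` (`IsWeight.laplace_logSum`), and that of the residue term is the principal part of
`L φ̂` at `1` (`laplace_logResidue`). So the Laplace transform of `Ψ` is the principal part minus
`L φ̂`. By hypothesis `Ψ(v) e ^ (-r₀ v)` is square integrable, hence the Laplace transform of `Ψ`
is holomorphic for `Re s > r₀` and, by Plancherel, in `H²` of that half-plane. By the identity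
theorem the relation persists there (`regular_eq_taylor_sub_laplace`). After multiplication by
`b_{1,r} ^ m` the principal part becomes a rational function of order `O(1 / |s|)` and without
poles in `Re s ≥ r`, while `g_A` is bounded; this proves `h ∈ H²` (`isTameHardy_h`).

The zero-free disc comes from the sharp point evaluation `4π (Re λ - σ) |f(λ)|² ≤ ‖f‖²`: if
`f(μ) = 0`, division by the Blaschke factor `b_μ` leaves the modulus of `f` unchanged on the
boundary line and yields `4π (Re λ - σ) |f(λ)|² ≤ |b_μ(λ)|² ‖f‖²`, where `|b_μ(λ)|` is the
pseudohyperbolic distance of `λ` and `μ` (`IsTameHardy.ne_zero_of_mem_disc`). To avoid boundary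
values, this is done on the lines `Re s = x` with the Blaschke factors of `Re s > x`, and then
`x → σ`. The point evaluation is Cauchy's formula on a half-plane for `f(s)² (s + conj λ - 2 x)`.
-/

namespace ZeroFree

/-! ### Cauchy's formula on a half-plane -/

theorem isOpen_halfPlane (σ : ℝ) : IsOpen (halfPlane σ) :=
  isOpen_lt continuous_const continuous_re

theorem convex_halfPlane (σ : ℝ) : Convex ℝ (halfPlane σ) :=
  convex_halfSpace_re_gt σ

/-- Points tending to infinity inside the closed half-plane `Re s ≥ x`. -/
noncomputable def atInftyIn (x : ℝ) : Filter ℂ := Bornology.cobounded ℂ ⊓ 𝓟 {s | x ≤ s.re}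

theorem inv_add_isBigO (x : ℝ) (c : ℂ) :
    (fun s : ℂ => (s + c)⁻¹) =O[atInftyIn x] fun s => ‖s‖⁻¹ := by
  refine Asymptotics.IsBigO.mono ?_ inf_le_left
  refine Asymptotics.IsBigO.of_bound 2 ?_
  have h1 : ∀ᶠ s : ℂ in Bornology.cobounded ℂ, 2 * ‖c‖ + 1 ≤ ‖s‖ :=
    tendsto_norm_cobounded_atTop.eventually_ge_atTop _
  filter_upwards [h1] with s hs
  have h2 : ‖s‖ ≤ ‖s + c‖ + ‖c‖ := by
    simpa using norm_sub_le (s + c) c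
  have h3 : ‖s‖ / 2 ≤ ‖s + c‖ := by linarith [norm_nonneg c]
  have h4 : 0 < ‖s‖ := by linarith [norm_nonneg c]
  rw [norm_inv, norm_inv, norm_norm, ← div_eq_mul_inv, inv_eq_one_div,
    div_le_div_iff₀ (by linarith) h4]
  linarith

theorem add_isBigO (x : ℝ) (c : ℂ) :
    (fun s : ℂ => s + c) =O[atInftyIn x] fun s => ‖s‖ := by
  refine Asymptotics.IsBigO.mono ?_ inf_le_left
  refine Asymptotics.IsBigO.of_bound 2 ?_
  have h1 : ∀ᶠ s : ℂ in Bornology.cobounded ℂ, ‖c‖ ≤ ‖s‖ :=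
    tendsto_norm_cobounded_atTop.eventually_ge_atTop _
  filter_upwards [h1] with s hs
  rw [norm_norm]
  linarith [norm_add_le s c]

theorem eventually_ne_atInftyIn (x : ℝ) (c : ℂ) : ∀ᶠ s in atInftyIn x, s ≠ c := by
  refine Filter.Eventually.filter_mono inf_le_left ?_
  have h1 : ∀ᶠ s : ℂ in Bornology.cobounded ℂ, ‖c‖ + 1 ≤ ‖s‖ :=
    tendsto_norm_cobounded_atTop.eventually_ge_atTop _
  filter_upwards [h1] with s hs h
  rw [h] at hs
  linarith

theorem tendsto_vertical_atInftyIn (x : ℝ) :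
    Tendsto (fun t : ℝ => (x + t * I : ℂ)) (cocompact ℝ) (atInftyIn x) := by
  refine tendsto_inf.2 ⟨?_, tendsto_principal.2 (Eventually.of_forall fun t => by simp)⟩
  rw [← tendsto_norm_atTop_iff_cobounded]
  refine tendsto_atTop_mono (fun t => ?_) tendsto_norm_cocompact_atTop
  simpa using abs_im_le_norm (x + t * I : ℂ)

/-- **Cauchy's theorem on a half-plane**: a function of order `O(|s|⁻²)` at infinity that is
holomorphic across the line `Re s = x` has vanishing integral along that line. -/
theorem integral_vertical_eq_zero {Φ : ℂ → ℂ} {σ x : ℝ} (hσ : σ < x)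
    (hΦ : DifferentiableOn ℂ Φ (halfPlane σ))
    (hO : Φ =O[atInftyIn x] fun s => (‖s‖ ^ 2)⁻¹) :
    Integrable (fun t : ℝ => Φ (x + t * I)) ∧ ∫ t : ℝ, Φ (x + t * I) = 0 := by
  have hline : Continuous fun t : ℝ => Φ (x + t * I) := by
    rw [← continuousOn_univ]
    refine hΦ.continuousOn.comp (by fun_prop) fun t _ => by simpa [halfPlane] using hσ
  have hint : Integrable (fun t : ℝ => Φ (x + t * I)) := by
    refine hline.locallyIntegrable.integrable_of_isBigO_cocompact
      (g := fun t : ℝ => (1 + t ^ 2)⁻¹) ?_ (integrable_inv_one_add_sq.integrableAtFilter _)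
    refine (hO.comp_tendsto (tendsto_vertical_atInftyIn x)).trans ?_
    refine Asymptotics.IsBigO.of_bound 2 ?_
    have h1 : ∀ᶠ t : ℝ in cocompact ℝ, 1 ≤ ‖t‖ :=
      tendsto_norm_cocompact_atTop.eventually_ge_atTop 1
    filter_upwards [h1] with t ht
    have h2 : ‖t‖ ≤ ‖(x + t * I : ℂ)‖ := by simpa using abs_im_le_norm (x + t * I : ℂ)
    have h3 : ‖t‖ ^ 2 ≤ ‖(x + t * I : ℂ)‖ ^ 2 := by gcongr
    have h4 : (1 : ℝ) ≤ ‖t‖ ^ 2 := one_le_pow₀ ht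
    have h5 : ‖t‖ ^ 2 = t ^ 2 := by simp
    simp only [Function.comp, norm_inv, norm_pow, norm_norm]
    rw [Real.norm_of_nonneg (by positivity), ← div_eq_mul_inv, inv_eq_one_div,
      div_le_div_iff₀ (by linarith) (by positivity)]
    linarith
  refine ⟨hint, ?_⟩
  obtain ⟨C, hC0, hC⟩ := hO.exists_nonneg
  rw [Asymptotics.isBigOWith_iff, atInftyIn, eventually_inf_principal,
    ← comap_norm_atTop, eventually_comap] at hC
  obtain ⟨R, hR⟩ := eventually_atTop.1 hC
  have hbd : ∀ s : ℂ, R ≤ ‖s‖ → x ≤ s.re → ‖Φ s‖ ≤ C * (‖s‖ ^ 2)⁻¹ := fun s h1 h2 => by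
    simpa using hR ‖s‖ h1 s rfl h2
  have hlim1 : Tendsto (fun T : ℝ => ∫ t in (-T)..T, Φ (x + t * I)) atTop
      (𝓝 (∫ t : ℝ, Φ (x + t * I))) :=
    intervalIntegral_tendsto_integral hint tendsto_neg_atTop_atBot tendsto_id
  refine tendsto_nhds_unique hlim1 ?_
  refine squeeze_zero_norm' (a := fun T => 16 * C * T⁻¹) ?_
    (by simpa using (tendsto_inv_atTop_zero (𝕜 := ℝ)).const_mul (16 * C))
  filter_upwards [eventually_ge_atTop (2 * |x|), eventually_ge_atTop (2 * R),
    eventually_gt_atTop 0] with T hT1 hT2 hT0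
  have hx1 := neg_abs_le x
  have hbig : ∀ s : ℂ, T / 2 ≤ ‖s‖ → x ≤ s.re → ‖Φ s‖ ≤ 4 * C / T ^ 2 := fun s h1 h2 => by
    refine (hbd s (by linarith) h2).trans ?_
    rw [show 4 * C / T ^ 2 = C * ((T / 2) ^ 2)⁻¹ by field_simp; ring]
    gcongr
  have hrect := integral_boundary_rect_eq_zero_of_differentiableOn Φ (x - T * I : ℂ)
    (x + T + T * I : ℂ) (hΦ.mono fun s hs => by
      have := hs.1
      simp only [sub_re, ofReal_re, mul_re, I_re, mul_zero, ofReal_im, I_im, mul_one, sub_self,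
        sub_zero, add_re, add_zero, Set.mem_preimage, Set.uIcc_of_le (by linarith : x ≤ x + T),
        Set.mem_Icc] at this
      exact lt_of_lt_of_le hσ this.1)
  simp only [sub_re, ofReal_re, mul_re, I_re, mul_zero, ofReal_im, I_im, mul_one, sub_self,
    sub_zero, add_re, add_zero, sub_im, mul_im, zero_sub, add_im, zero_add] at hrect
  have b1 : ‖∫ y in x..(x + T), Φ (y + ((-T : ℝ) : ℂ) * I)‖ ≤ 4 * C / T ^ 2 * |x + T - x| :=
    intervalIntegral.norm_integral_le_of_norm_le_const fun y hy => by
      rw [Set.uIoc_of_le (by linarith)] at hy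
      refine hbig _ ?_ (by simpa using hy.1.le)
      have := abs_im_le_norm (y + ((-T : ℝ) : ℂ) * I)
      simp [abs_of_pos hT0] at this
      simp
      linarith
  have b2 : ‖∫ y in x..(x + T), Φ (y + T * I)‖ ≤ 4 * C / T ^ 2 * |x + T - x| :=
    intervalIntegral.norm_integral_le_of_norm_le_const fun y hy => by
      rw [Set.uIoc_of_le (by linarith)] at hy
      refine hbig _ ?_ (by simpa using hy.1.le)
      have := abs_im_le_norm (y + T * I)
      simp [abs_of_pos hT0] at this
      linarith
  have b3 : ‖∫ y in (-T)..T, Φ (((x + T : ℝ) : ℂ) + y * I)‖ ≤ 4 * C / T ^ 2 * |T - -T| :=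
    intervalIntegral.norm_integral_le_of_norm_le_const fun y hy => by
      refine hbig _ ?_ (by simpa using hT0.le)
      have := re_le_norm (((x + T : ℝ) : ℂ) + y * I)
      simp at this
      push_cast
      linarith
  have key : I * (∫ t in (-T)..T, Φ (x + t * I)) =
      (∫ y in x..(x + T), Φ (y + ((-T : ℝ) : ℂ) * I)) - (∫ y in x..(x + T), Φ (y + T * I))
        + I * ∫ y in (-T)..T, Φ (((x + T : ℝ) : ℂ) + y * I) := by
    simp only [smul_eq_mul] at hrect
    linear_combination -hrect
  have : ‖∫ t in (-T)..T, Φ (x + t * I)‖ = ‖I * (∫ t in (-T)..T, Φ (x + t * I))‖ := by simp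
  rw [this, key]
  refine (norm_add_le _ _).trans ?_
  refine (add_le_add (norm_sub_le _ _) le_rfl).trans ?_
  rw [norm_mul, norm_I, one_mul]
  refine (add_le_add (add_le_add b1 b2) b3).trans (le_of_eq ?_)
  rw [show x + T - x = T by ring, show T - -T = 2 * T by ring, abs_of_pos hT0,
    abs_of_pos (by linarith)]
  field_simp
  ring

/-- The Poisson kernel `2d / (d² + (t - τ)²)` has total mass `2π`. -/
theorem integral_poisson {d : ℝ} (hd : 0 < d) (τ : ℝ) :
    Integrable (fun t : ℝ => 2 * d / (d ^ 2 + (t - τ) ^ 2)) ∧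
      ∫ t : ℝ, 2 * d / (d ^ 2 + (t - τ) ^ 2) = 2 * Real.pi := by
  have e : (fun t : ℝ => 2 * d / (d ^ 2 + (t - τ) ^ 2)) =
      fun t => (2 / d) * (1 + (d⁻¹ * (t - τ)) ^ 2)⁻¹ := by
    funext t
    field_simp
  rw [e]
  constructor
  · exact ((integrable_inv_one_add_sq.comp_mul_left' (inv_ne_zero hd.ne')).comp_sub_right
      τ).const_mul _
  · rw [integral_const_mul, integral_sub_right_eq_self (fun t => (1 + (d⁻¹ * t) ^ 2)⁻¹) τ,
      Measure.integral_comp_mul_left (fun t : ℝ => (1 + t ^ 2)⁻¹) d⁻¹,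
      integral_univ_inv_one_add_sq, inv_inv, abs_of_pos hd, smul_eq_mul]
    field_simp

theorem ne_zero_of_re_pos {z : ℂ} (h : 0 < z.re) : z ≠ 0 := fun h0 => by simp [h0] at h

/-- **Cauchy's integral formula on a half-plane** for functions of order `O(|s|⁻¹)`. -/
theorem integral_vertical_div {H : ℂ → ℂ} {σ x : ℝ} (hσ : σ < x)
    (hH : DifferentiableOn ℂ H (halfPlane σ))
    (hO : H =O[atInftyIn x] fun s => ‖s‖⁻¹) {lam : ℂ} (hlam : x < lam.re) :
    ∫ t : ℝ, H (x + t * I) / (lam - (x + t * I)) = 2 * Real.pi * H lam := by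
  set d := lam.re - x with hd
  have hd0 : 0 < d := by simp only [hd]; linarith
  -- subtract a multiple of a rational function whose integral is a Poisson integral, so as
  -- to cancel the pole at `lam`
  set k : ℂ → ℂ := fun s => 2 * d * (s + (conj lam - 2 * x))⁻¹ with hk
  set σ' := max σ (x - d) with hσ'
  have hσ'x : σ' < x := max_lt hσ (by linarith)
  have hne : ∀ s ∈ halfPlane σ', s + (conj lam - 2 * x) ≠ 0 := fun s hs =>
    ne_zero_of_re_pos (by
      have : x - d < s.re := (le_max_right _ _).trans_lt hs
      simp only [add_re, sub_re, conj_re, mul_re, re_ofNat, ofReal_re, im_ofNat, ofReal_im]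
      linarith)
  have hkdiff : DifferentiableOn ℂ k (halfPlane σ') := by
    refine DifferentiableOn.const_mul ?_ _
    exact DifferentiableOn.inv (by fun_prop) hne
  set q : ℂ → ℂ := fun s => H s - H lam * k s with hq
  have hqdiff : DifferentiableOn ℂ q (halfPlane σ') :=
    (hH.mono fun s (hs : σ' < s.re) => (le_max_left σ (x - d)).trans_lt hs).sub
      (hkdiff.const_mul _)
  have hklam : k lam = 1 := by
    have h1 : lam + (conj lam - 2 * x) = ((2 * d : ℝ) : ℂ) := by
      apply Complex.ext <;> simp [hd]; ring
    simp only [hk, h1]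
    have hd1 : (d : ℂ) ≠ 0 := by exact_mod_cast hd0.ne'
    push_cast
    field_simp
  have hqlam : q lam = 0 := by simp [hq, hklam]
  have hlam' : lam ∈ halfPlane σ' := hσ'x.trans hlam
  have hdsl : ∀ s, s ≠ lam → dslope q lam s = q s * (s + -lam)⁻¹ := fun s hs => by
    rw [dslope_of_ne _ hs, slope_def_field, hqlam, sub_zero, div_eq_mul_inv, sub_eq_add_neg]
  have hqO : q =O[atInftyIn x] fun s => ‖s‖⁻¹ :=
    hO.sub (((inv_add_isBigO x _).const_mul_left _).const_mul_left _)
  obtain ⟨i1, i2⟩ := integral_vertical_eq_zero hσ'x (Φ := dslope q lam)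
    ((differentiableOn_dslope ((isOpen_halfPlane σ').mem_nhds hlam')).2 hqdiff) (by
      have := hqO.mul (inv_add_isBigO x (-lam))
      refine (this.congr' ?_ ?_)
      · filter_upwards [eventually_ne_atInftyIn x lam] with s hs
        rw [hdsl s hs]
      · refine Eventually.of_forall fun s => ?_
        simp only [sq, mul_inv])
  obtain ⟨p1, p2⟩ := integral_poisson hd0 lam.im
  have e : ∀ t : ℝ, H (x + t * I) / (lam - (x + t * I)) =
      -dslope q lam (x + t * I) + H lam * ((2 * d / (d ^ 2 + (t - lam.im) ^ 2) : ℝ) : ℂ) := by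
    intro t
    have hn : (x + t * I : ℂ) ≠ lam := fun h => by
      have := congrArg re h
      simp at this
      linarith
    have hn2 : (x + t * I : ℂ) + -lam ≠ 0 := by
      rw [← sub_eq_add_neg]; exact sub_ne_zero.2 hn
    have hn2' : lam - (x + t * I : ℂ) ≠ 0 := sub_ne_zero.2 hn.symm
    have hn3 : (x + t * I : ℂ) + (conj lam - 2 * x) ≠ 0 := hne _ (by simpa [halfPlane] using hσ'x)
    have h4 : (((d ^ 2 + (t - lam.im) ^ 2 : ℝ)) : ℂ) =
        (lam - (x + t * I)) * ((x + t * I : ℂ) + (conj lam - 2 * x)) := by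
      apply Complex.ext <;> simp [hd, sq] <;> ring
    have h5 : (lam - (x + t * I : ℂ)) = -((x + t * I : ℂ) + -lam) := by ring
    rw [hdsl _ hn, ofReal_div, h4]
    simp only [hq, hk]
    push_cast
    rw [h5]
    field_simp
    ring
  simp_rw [e]
  have p3 : Integrable (fun t : ℝ =>
      H lam * ((2 * d / (d ^ 2 + (t - lam.im) ^ 2) : ℝ) : ℂ)) := p1.ofReal.const_mul _
  rw [integral_add (f := fun t : ℝ => -dslope q lam (x + t * I)) i1.neg p3, integral_neg,
    i2, integral_const_mul,
    integral_complex_ofReal, p2]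
  push_cast
  ring

/-! ### Sharp point evaluation in the Hardy space -/

/-- The points `lam` and `2 x - conj lam` are symmetric about the line `Re s = x`. -/
theorem norm_re_reflect (x t : ℝ) (lam : ℂ) :
    ‖(x + t * I : ℂ) + (conj lam - 2 * x)‖ = ‖lam - (x + t * I)‖ := by
  rw [← norm_conj]
  congr 1
  apply Complex.ext <;> simp <;> ring

/-- **Sharp point evaluation on a half-plane**. The bound results from Cauchy's formula for
`f(s)² (s + conj lam - 2 x)`, because `s + conj lam - 2 x` and `lam - s` have the same modulus on
the line `Re s = x`. -/
theorem point_evaluation_le {f : ℂ → ℂ} {σ x : ℝ} (hσ : σ < x)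
    (hf : DifferentiableOn ℂ f (halfPlane σ))
    (hO : f =O[atInftyIn x] fun _ => (1 : ℝ)) {lam : ℂ} (hlam : x < lam.re) :
    ENNReal.ofReal (4 * Real.pi * (lam.re - x) * ‖f lam‖ ^ 2) ≤
      ∫⁻ t : ℝ, ‖f (x + t * I)‖ₑ ^ 2 := by
  -- the factor `1 + ε (s - x)`, of modulus at least `1` for `Re s ≥ x`, provides decay
  have main : ∀ ε : ℝ, 0 < ε →
      ENNReal.ofReal (4 * Real.pi * (lam.re - x) * ‖f lam / (1 + ε * (lam - x))‖ ^ 2) ≤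
      ∫⁻ t : ℝ, ‖f (x + t * I)‖ₑ ^ 2 := by
    intro ε hε
    set H : ℂ → ℂ := fun s => (f s / (1 + ε * (s - x))) ^ 2 * (s + (conj lam - 2 * x)) with hH
    have hre : ∀ s : ℂ, (1 + ε * (s - x) : ℂ).re = 1 + ε * (s.re - x) := fun s => by simp
    set σ' := max σ (x - ε⁻¹) with hσ'
    have hσ'x : σ' < x := max_lt hσ (by linarith [inv_pos.2 hε])
    have hdiff : DifferentiableOn ℂ H (halfPlane σ') := by
      refine DifferentiableOn.mul (DifferentiableOn.pow (DifferentiableOn.div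
        (hf.mono fun s (hs : σ' < s.re) => (le_max_left σ (x - ε⁻¹)).trans_lt hs) (by fun_prop)
        fun s hs => ?_) _)
        (by fun_prop)
      refine ne_zero_of_re_pos ?_
      rw [hre]
      have : x - ε⁻¹ < s.re := (le_max_right _ _).trans_lt hs
      have h2 := mul_lt_mul_of_pos_left (show -ε⁻¹ < s.re - x by linarith) hε
      rw [mul_neg, mul_inv_cancel₀ hε.ne'] at h2
      linarith
    have hHO : H =O[atInftyIn x] fun s => ‖s‖⁻¹ := by
      have h1 := (((hO.mul ((inv_add_isBigO x (ε⁻¹ - x)).const_mul_left (ε⁻¹ : ℂ))).pow 2).mul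
        (add_isBigO x (conj lam - 2 * x)))
      refine h1.congr' (Eventually.of_forall fun s => ?_) ?_
      · simp only [hH]
        congr 2
        have hε' : (ε : ℂ) ≠ 0 := by exact_mod_cast hε.ne'
        rw [div_eq_mul_inv, ← mul_inv]
        congr 2
        rw [mul_add, mul_sub, ofReal_inv, mul_inv_cancel₀ hε']
        ring
      · filter_upwards [eventually_ne_atInftyIn x 0] with s hs
        have : ‖s‖ ≠ 0 := norm_ne_zero_iff.2 hs
        field_simp
    have hC := integral_vertical_div hσ'x hdiff hHO hlam
    have hHl : ‖2 * Real.pi * H lam‖ =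
        4 * Real.pi * (lam.re - x) * ‖f lam / (1 + ε * (lam - x))‖ ^ 2 := by
      have h1 : lam + (conj lam - 2 * x) = ((2 * (lam.re - x) : ℝ) : ℂ) := by
        apply Complex.ext <;> simp; ring
      simp only [hH, h1]
      rw [norm_mul, norm_mul, norm_mul, norm_pow, norm_real, norm_real,
        Real.norm_of_nonneg Real.pi_pos.le, Real.norm_of_nonneg (by linarith)]
      simp only [RCLike.norm_ofNat]
      ring
    rw [← hHl, ← hC, ofReal_norm]
    refine (enorm_integral_le_lintegral_enorm _).trans (lintegral_mono fun t => ?_)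
    simp only [hH]
    have hn2 : lam - (x + t * I : ℂ) ≠ 0 := ne_zero_of_re_pos (by simpa using hlam)
    have h3 : ‖(f (x + t * I) / (1 + ε * ((x + t * I : ℂ) - x))) ^ 2 *
        ((x + t * I : ℂ) + (conj lam - 2 * x)) / (lam - (x + t * I))‖ ≤ ‖f (x + t * I)‖ ^ 2 := by
      rw [norm_div, norm_mul, norm_re_reflect, mul_div_assoc, div_self (norm_ne_zero_iff.2 hn2),
        mul_one, norm_pow, norm_div]
      gcongr
      refine div_le_self (norm_nonneg _) ?_
      refine le_trans ?_ (re_le_norm _)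
      rw [hre]
      simp
    have h4 := ENNReal.ofReal_le_ofReal h3
    rwa [ofReal_norm, ENNReal.ofReal_pow (norm_nonneg _), ofReal_norm] at h4
  have hcont : ContinuousAt (fun ε : ℝ => ENNReal.ofReal
      (4 * Real.pi * (lam.re - x) * ‖f lam / (1 + ε * (lam - x))‖ ^ 2)) 0 := by
    refine ENNReal.continuous_ofReal.continuousAt.comp ?_
    have : ContinuousAt (fun ε : ℝ => f lam / (1 + ε * (lam - x))) 0 :=
      ContinuousAt.div (by fun_prop) (by fun_prop) (by simp)
    fun_prop
  have hl : Tendsto (fun ε : ℝ => ENNReal.ofReal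
      (4 * Real.pi * (lam.re - x) * ‖f lam / (1 + ε * (lam - x))‖ ^ 2)) (𝓝[>] 0)
      (𝓝 (ENNReal.ofReal (4 * Real.pi * (lam.re - x) * ‖f lam‖ ^ 2))) := by
    have := hcont.tendsto.mono_left (nhdsWithin_le_nhds (s := Set.Ioi 0))
    simpa using this
  exact le_of_tendsto hl (eventually_nhdsWithin_of_forall fun ε hε => main ε hε)

/-- Point evaluation for a function with a zero `μ`: dividing by the Blaschke factor of `μ`
improves the bound by the modulus of that factor. -/
theorem point_evaluation_le_of_zero {f : ℂ → ℂ} {σ x : ℝ} (hσ : σ < x)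
    (hf : DifferentiableOn ℂ f (halfPlane σ))
    (hO : f =O[atInftyIn x] fun _ => (1 : ℝ)) {lam μ : ℂ} (hlam : x < lam.re) (hμ : x < μ.re)
    (hfμ : f μ = 0) (hne : lam ≠ μ) :
    ENNReal.ofReal (4 * Real.pi * (lam.re - x) *
        (‖f lam‖ * (‖lam + conj μ - 2 * x‖ / ‖lam - μ‖)) ^ 2) ≤
      ∫⁻ t : ℝ, ‖f (x + t * I)‖ₑ ^ 2 := by
  set G : ℂ → ℂ := fun s => dslope f μ s * (s + (conj μ - 2 * x)) with hG
  have hdsl : ∀ s, s ≠ μ → dslope f μ s = f s * (s + -μ)⁻¹ := fun s hs => by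
    rw [dslope_of_ne _ hs, slope_def_field, hfμ, sub_zero, div_eq_mul_inv, sub_eq_add_neg]
  have hGd : DifferentiableOn ℂ G (halfPlane σ) :=
    ((differentiableOn_dslope ((isOpen_halfPlane σ).mem_nhds (hσ.trans hμ))).2 hf).mul
      (by fun_prop)
  have hGO : G =O[atInftyIn x] fun _ => (1 : ℝ) := by
    refine ((hO.mul (inv_add_isBigO x (-μ))).mul (add_isBigO x (conj μ - 2 * x))).congr' ?_ ?_
    · filter_upwards [eventually_ne_atInftyIn x μ] with s hs
      simp only [hG, hdsl s hs]
    · filter_upwards [eventually_ne_atInftyIn x 0] with s hs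
      have : ‖s‖ ≠ 0 := norm_ne_zero_iff.2 hs
      field_simp
  have key := point_evaluation_le hσ hGd hGO hlam
  have h1 : ‖G lam‖ = ‖f lam‖ * (‖lam + conj μ - 2 * x‖ / ‖lam - μ‖) := by
    simp only [hG, hdsl lam hne]
    rw [norm_mul, norm_mul, norm_inv, ← sub_eq_add_neg, ← add_sub_assoc, div_eq_mul_inv]
    ring
  rw [h1] at key
  refine key.trans_eq (lintegral_congr fun t => ?_)
  have hn : (x + t * I : ℂ) ≠ μ := fun h => by
    have := congrArg re h
    simp at this
    linarith
  have h2 : ‖G (x + t * I)‖ = ‖f (x + t * I)‖ := by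
    simp only [hG, hdsl _ hn]
    rw [norm_mul, norm_re_reflect, norm_mul, norm_inv, ← sub_eq_add_neg, norm_sub_rev,
      mul_assoc, inv_mul_cancel₀ (norm_ne_zero_iff.2 (sub_ne_zero.2 hn.symm)), mul_one]
  rw [← ofReal_norm, h2, ofReal_norm]

theorem lintegral_vertical_le_hardyENorm {f : ℂ → ℂ} {σ x : ℝ} (hσ : σ < x) :
    ∫⁻ t : ℝ, ‖f (x + t * I)‖ₑ ^ 2 ≤ hardyENorm σ f ^ 2 := by
  have h1 : (∫⁻ t : ℝ, ‖f (x + t * I)‖ₑ ^ 2) ^ (1 / 2 : ℝ) ≤ hardyENorm σ f :=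
    le_iSup₂ (f := fun (x : ℝ) (_ : σ < x) => (∫⁻ t : ℝ, ‖f (x + t * I)‖ₑ ^ 2) ^ (1 / 2 : ℝ)) x hσ
  refine le_trans (le_of_eq ?_) (pow_le_pow_left' h1 2)
  rw [← ENNReal.rpow_natCast, ← ENNReal.rpow_mul]
  norm_num

/-- Membership in `H²` together with boundedness near infinity on smaller closed half-planes.
Every element of `H²` has the second property. -/
structure IsTameHardy (σ : ℝ) (f : ℂ → ℂ) : Prop where
  memHardy : MemHardy σ f
  isBigO_one : ∀ x, σ < x → f =O[atInftyIn x] fun _ => (1 : ℝ)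

/-- Passage to the boundary: a continuous lower bound for the `L²` integrals over the lines
`Re s = x` bounds the Hardy norm from below in the limit `x → σ`. -/
theorem sq_le_hardyNorm_sq {σ c : ℝ} {f : ℂ → ℂ} (hf : MemHardy σ f) {F : ℝ → ℝ}
    (hF : ContinuousAt F σ) (hc : σ < c)
    (h : ∀ x, σ < x → x < c → ENNReal.ofReal (F x) ≤ ∫⁻ t : ℝ, ‖f (x + t * I)‖ₑ ^ 2) :
    F σ ≤ hardyNorm σ f ^ 2 := by
  refine le_of_tendsto (hF.tendsto.mono_left (nhdsWithin_le_nhds (s := Set.Ioi σ))) ?_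
  filter_upwards [Ioo_mem_nhdsGT hc] with x hx
  have h1 := (h x hx.1 hx.2).trans (lintegral_vertical_le_hardyENorm hx.1)
  rw [hardyNorm, ← ENNReal.toReal_pow]
  exact (ENNReal.ofReal_le_iff_le_toReal (ENNReal.pow_ne_top hf.2.ne)).1 h1

theorem IsTameHardy.point_evaluation {σ : ℝ} {f : ℂ → ℂ} (hf : IsTameHardy σ f) {lam : ℂ}
    (hlam : σ < lam.re) :
    4 * Real.pi * (lam.re - σ) * ‖f lam‖ ^ 2 ≤ hardyNorm σ f ^ 2 :=
  sq_le_hardyNorm_sq (F := fun x => 4 * Real.pi * (lam.re - x) * ‖f lam‖ ^ 2) hf.memHardy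
    (by fun_prop) hlam fun x hx hxc => by
      obtain ⟨y, hy1, hy2⟩ := exists_between hx
      exact point_evaluation_le hy2 (hf.memHardy.1.differentiableOn.mono
        fun s hs => hy1.trans hs) (hf.isBigO_one x hx) hxc

/-- If `f μ = 0`, point evaluation at `lam` gains the modulus of the Blaschke factor of `μ` at
`lam`. -/
theorem IsTameHardy.point_evaluation_of_zero {σ : ℝ} {f : ℂ → ℂ} (hf : IsTameHardy σ f)
    {lam μ : ℂ} (hlam : σ < lam.re) (hμ : σ < μ.re) (hfμ : f μ = 0) (hne : lam ≠ μ) :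
    4 * Real.pi * (lam.re - σ) * (‖f lam‖ * (‖lam + conj μ - 2 * σ‖ / ‖lam - μ‖)) ^ 2 ≤
      hardyNorm σ f ^ 2 :=
  sq_le_hardyNorm_sq (F := fun x => 4 * Real.pi * (lam.re - x) *
      (‖f lam‖ * (‖lam + conj μ - 2 * x‖ / ‖lam - μ‖)) ^ 2) hf.memHardy
    (by fun_prop) (lt_min hlam hμ) fun x hx hxc => by
      obtain ⟨y, hy1, hy2⟩ := exists_between hx
      exact point_evaluation_le_of_zero hy2 (hf.memHardy.1.differentiableOn.mono
        fun s hs => hy1.trans hs) (hf.isBigO_one x hx) (hxc.trans_le (min_le_left _ _))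
        (hxc.trans_le (min_le_right _ _)) hfμ hne

/-- The points of `disc σ lam R`, with the radius `R` given by the point evaluation of `f`
at `lam`, belong to the half-plane and are not zeros of `f`. -/
theorem IsTameHardy.ne_zero_of_mem_disc {σ : ℝ} {f : ℂ → ℂ} (hf : IsTameHardy σ f)
    {lam μ : ℂ} (hlam : σ < lam.re)
    (hμ : μ ∈ disc σ lam (Real.sqrt (4 * Real.pi * (lam.re - σ)) *
      (‖f lam‖ / hardyNorm σ f))) :
    σ < μ.re ∧ f μ ≠ 0 := by
  obtain ⟨hden, hlt⟩ := hμ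
  set R := Real.sqrt (4 * Real.pi * (lam.re - σ)) * (‖f lam‖ / hardyNorm σ f) with hR
  have hN0 : 0 ≤ hardyNorm σ f := ENNReal.toReal_nonneg
  have hN : 0 < hardyNorm σ f := by
    refine lt_of_le_of_ne hN0 fun h => ?_
    rw [hR, ← h, div_zero, mul_zero] at hlt
    exact absurd hlt (not_lt.2 (norm_nonneg _))
  have hk : 0 ≤ 4 * Real.pi * (lam.re - σ) :=
    mul_nonneg (by positivity) (by linarith)
  have hR0 : 0 ≤ R := by positivity
  have hRsq : R ^ 2 = 4 * Real.pi * (lam.re - σ) * ‖f lam‖ ^ 2 / hardyNorm σ f ^ 2 := by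
    rw [hR, mul_pow, Real.sq_sqrt hk, div_pow, mul_div_assoc]
  -- by the point evaluation the pseudohyperbolic radius is at most one, which forces `σ < Re μ`
  have hR1 : R ≤ 1 := by
    have := hf.point_evaluation hlam
    rw [← sq_le_one_iff₀ hR0, hRsq]
    exact div_le_one_of_le₀ this (by positivity)
  have hdpos : 0 < ‖μ + conj lam - 2 * σ‖ := norm_pos_iff.2 hden
  have hμre : σ < μ.re := by
    have h1 := hlt.trans_le hR1
    rw [norm_div, div_lt_one hdpos] at h1
    have h2 : ‖μ - lam‖ ^ 2 < ‖μ + conj lam - 2 * σ‖ ^ 2 := by gcongr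
    rw [← normSq_eq_norm_sq, ← normSq_eq_norm_sq, normSq_apply, normSq_apply] at h2
    simp at h2
    have h3 : 0 < (lam.re - σ) * (μ.re - σ) := by nlinarith
    have := pos_of_mul_pos_right h3 (by linarith)
    linarith
  refine ⟨hμre, fun hfμ => ?_⟩
  have hfl : f lam ≠ 0 := fun h => by
    rw [hR, h, norm_zero, zero_div, mul_zero] at hlt
    exact absurd hlt (not_lt.2 (norm_nonneg _))
  have hne : lam ≠ μ := fun h => hfl (h ▸ hfμ)
  have key := hf.point_evaluation_of_zero hlam hμre hfμ hne
  have hconj : ‖lam + conj μ - 2 * σ‖ = ‖μ + conj lam - 2 * σ‖ := by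
    rw [← norm_conj]
    congr 1
    apply Complex.ext <;> simp [add_comm]
  have hb : 0 < ‖lam - μ‖ := norm_pos_iff.2 (sub_ne_zero.2 hne)
  rw [norm_div, norm_sub_rev, div_lt_iff₀ hdpos] at hlt
  have hlt2 : ‖lam - μ‖ ^ 2 < (R * ‖μ + conj lam - 2 * σ‖) ^ 2 := by gcongr
  rw [mul_pow, hRsq] at hlt2
  rw [hconj, mul_pow, div_pow] at key
  have hNN : 0 < hardyNorm σ f ^ 2 := by positivity
  rw [div_mul_eq_mul_div, lt_div_iff₀ hNN] at hlt2
  rw [← mul_assoc, ← mul_div_assoc, div_le_iff₀ (by positivity)] at key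
  linarith

/-! ### Plancherel's theorem on `L¹ ∩ L²` -/

open scoped FourierTransform ContDiff in
/-- On `L¹ ∩ L²` the Fourier integral agrees with the Fourier transform of `L²`, because the two
coincide as tempered distributions. -/
theorem fourier_toLp_ae_eq {f : ℝ → ℂ} (h1 : Integrable f) (h2 : MemLp f 2) :
    (𝓕 (h2.toLp f) : Lp ℂ 2 (volume : Measure ℝ)) =ᵐ[volume] 𝓕 f := by
  have hloc : LocallyIntegrable (𝓕 f) volume :=
    Continuous.locallyIntegrable (VectorFourier.fourierIntegral_continuous
      Real.continuous_fourierChar continuous_inner h1)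
  refine ae_eq_of_integral_contDiff_smul_eq ((Lp.memLp _).locallyIntegrable (by norm_num)) hloc ?_
  intro g hg hc
  have hg₁ : HasCompactSupport (Complex.ofRealCLM ∘ g) := hc.comp_left rfl
  have hg₂ : ContDiff ℝ ∞ (Complex.ofRealCLM ∘ g) := by fun_prop
  set G := hg₁.toSchwartzMap hg₂ with hG
  have hGa : ∀ x, G x = (g x : ℂ) := fun x => rfl
  have key := congrArg (fun T => T G) (Lp.fourier_toTemperedDistribution_eq (h2.toLp f))
  simp only [TemperedDistribution.fourier_apply, Lp.toTemperedDistribution_apply] at key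
  have e1 : ∫ x, g x • (𝓕 (h2.toLp f) : Lp ℂ 2 (volume : Measure ℝ)) x =
      ∫ x, G x • (𝓕 (h2.toLp f) : Lp ℂ 2 (volume : Measure ℝ)) x := by
    simp [hGa]
  have e2 : ∫ x, (𝓕 G) x • (h2.toLp f) x = ∫ x, (𝓕 G) x • f x := by
    refine integral_congr_ae ?_
    filter_upwards [h2.coeFn_toLp] with x hx
    rw [hx]
  have e3 := VectorFourier.integral_fourierIntegral_smul_eq_flip (μ := volume) (ν := volume)
    (L := innerₗ ℝ) Real.continuous_fourierChar continuous_inner G.integrable h1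
  rw [e1, ← key, e2]
  refine Eq.trans ?_ (e3.trans ?_)
  · rfl
  · rw [flip_innerₗ]
    simp [hGa]
    rfl

open scoped FourierTransform in
/-- **Plancherel's theorem** for the Fourier integral on `L¹ ∩ L²`. -/
theorem lintegral_enorm_fourier_sq {f : ℝ → ℂ} (h1 : Integrable f) (h2 : MemLp f 2) :
    ∫⁻ ξ, ‖𝓕 f ξ‖ₑ ^ 2 = ∫⁻ v, ‖f v‖ₑ ^ 2 := by
  have aux : ∀ g : ℝ → ℂ, ∫⁻ v, ‖g v‖ₑ ^ 2 = eLpNorm g 2 volume ^ 2 := fun g => by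
    have := eLpNorm_nnreal_pow_eq_lintegral (f := g) (μ := volume) (p := 2) two_ne_zero
    simpa using this.symm
  rw [aux, aux]
  congr 1
  rw [← eLpNorm_congr_ae (fourier_toLp_ae_eq h1 h2), ← eLpNorm_congr_ae h2.coeFn_toLp,
    ← Lp.enorm_def, ← Lp.enorm_def, ← ofReal_norm, ← ofReal_norm, Lp.norm_fourier_eq]

theorem lintegral_comp_div {g : ℝ → ℝ≥0∞} {a : ℝ} (ha : 0 < a) :
    ∫⁻ t, g (t / a) = ENNReal.ofReal a * ∫⁻ t, g t := by
  have h := (measurableEmbedding_mulRight₀ (inv_ne_zero ha.ne')).lintegral_map (μ := volume) g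
  rw [Real.map_volume_mul_right (inv_ne_zero ha.ne'), inv_inv, abs_of_pos ha,
    lintegral_smul_measure, smul_eq_mul] at h
  simpa [div_eq_mul_inv] using h.symm

/-! ### The two-sided Laplace transform -/

/-- The two-sided Laplace transform of `f`. -/
noncomputable def laplace (f : ℝ → ℂ) (s : ℂ) : ℂ := ∫ v : ℝ, cexp (-s * v) * f v

theorem norm_cexp_neg_mul_ofReal (s : ℂ) (v : ℝ) : ‖cexp (-s * v)‖ = Real.exp (-s.re * v) := by
  rw [norm_exp]; simp

open scoped FourierTransform in
theorem laplace_eq_fourier (f : ℝ → ℂ) (x t : ℝ) :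
    laplace f (x + t * I) = 𝓕 (fun v : ℝ => cexp (-x * v) * f v) (t / (2 * Real.pi)) := by
  rw [laplace, Real.fourier_eq']
  refine integral_congr_ae (Eventually.of_forall fun v => ?_)
  simp only [smul_eq_mul, ← mul_assoc, ← Complex.exp_add]
  congr 2
  have : (Real.pi : ℂ) ≠ 0 := by exact_mod_cast Real.pi_ne_zero
  simp only [RCLike.inner_apply, conj_trivial]
  push_cast
  field_simp
  ring

/-- **Plancherel's theorem** for the Laplace transform along a vertical line. -/
theorem lintegral_enorm_laplace_sq {f : ℝ → ℂ} {x : ℝ}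
    (h1 : Integrable fun v : ℝ => cexp (-x * v) * f v)
    (h2 : MemLp (fun v : ℝ => cexp (-x * v) * f v) 2) :
    ∫⁻ t : ℝ, ‖laplace f (x + t * I)‖ₑ ^ 2 =
      ENNReal.ofReal (2 * Real.pi) * ∫⁻ v : ℝ, ‖cexp (-x * v) * f v‖ₑ ^ 2 := by
  simp_rw [laplace_eq_fourier]
  rw [lintegral_comp_div (g := fun t => ‖FourierTransform.fourier
    (fun v : ℝ => cexp (-x * v) * f v) t‖ₑ ^ 2) (by positivity), lintegral_enorm_fourier_sq h1 h2]

theorem aestronglyMeasurable_of_exp_mul {f : ℝ → ℂ} {s : ℂ}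
    (h : AEStronglyMeasurable (fun v : ℝ => cexp (-s * v) * f v)) : AEStronglyMeasurable f := by
  have h2 : AEStronglyMeasurable (fun v : ℝ => cexp (s * v) * (cexp (-s * v) * f v)) :=
    (Continuous.aestronglyMeasurable (by fun_prop)).mul h
  refine h2.congr (Eventually.of_forall fun v => ?_)
  simp only [← mul_assoc, ← Complex.exp_add]
  simp

theorem integrable_exp_mul_of_re_le {f : ℝ → ℂ} {z s : ℂ}
    (h : Integrable fun v : ℝ => cexp (-z * v) * f v) (hf : ∀ v < 0, f v = 0)
    (hs : z.re ≤ s.re) : Integrable fun v : ℝ => cexp (-s * v) * f v := by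
  refine h.mono ((Continuous.aestronglyMeasurable (by fun_prop)).mul
    (aestronglyMeasurable_of_exp_mul h.1)) (Eventually.of_forall fun v => ?_)
  rcases lt_or_ge v 0 with hv | hv
  · simp [hf v hv]
  · simp only [norm_mul, norm_cexp_neg_mul_ofReal]
    gcongr

theorem norm_laplace_le {f : ℝ → ℂ} {z s : ℂ}
    (h : Integrable fun v : ℝ => cexp (-z * v) * f v) (hf : ∀ v < 0, f v = 0)
    (hs : z.re ≤ s.re) : ‖laplace f s‖ ≤ ∫ v : ℝ, ‖cexp (-z * v) * f v‖ := by
  refine (norm_integral_le_integral_norm _).trans (integral_mono_of_nonneg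
    (Eventually.of_forall fun v => norm_nonneg _) h.norm (Eventually.of_forall fun v => ?_))
  rcases lt_or_ge v 0 with hv | hv
  · simp [hf v hv]
  · simp only [norm_mul, norm_cexp_neg_mul_ofReal]
    gcongr

/-- For `f` vanishing on the negative half-line, absolute convergence at `z` gives holomorphy in
`Re s > Re z`. -/
theorem differentiableAt_laplace {f : ℝ → ℂ} {z s : ℂ}
    (h : Integrable fun v : ℝ => cexp (-z * v) * f v) (hf : ∀ v < 0, f v = 0)
    (hs : z.re < s.re) : DifferentiableAt ℂ (laplace f) s := by
  set δ := (s.re - z.re) / 2 with hδ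
  have hδ0 : 0 < δ := by simp only [hδ]; linarith
  have hm := aestronglyMeasurable_of_exp_mul h.1
  refine (hasDerivAt_integral_of_dominated_loc_of_deriv_le (𝕜 := ℂ)
    (F := fun (s : ℂ) (v : ℝ) => cexp (-s * v) * f v)
    (F' := fun (s : ℂ) (v : ℝ) => cexp (-s * v) * (-v) * f v)
    (bound := fun v : ℝ => δ⁻¹ * ‖cexp (-z * v) * f v‖)
    (Metric.ball_mem_nhds s hδ0)
    (Eventually.of_forall fun s => (Continuous.aestronglyMeasurable (by fun_prop)).mul hm)
    (integrable_exp_mul_of_re_le h hf hs.le)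
    ((Continuous.aestronglyMeasurable (by fun_prop)).mul hm)
    (Eventually.of_forall fun v w hw => ?_) (h.norm.const_mul _)
    (Eventually.of_forall fun v w hw => ?_)).2.differentiableAt
  · rcases lt_or_ge v 0 with hv | hv
    · simp [hf v hv]
    · have hw' : s.re - w.re < δ := by
        have h1 : ‖w - s‖ < δ := by simpa [dist_eq_norm] using hw
        have h2 := abs_re_le_norm (w - s)
        have h3 := neg_abs_le (w - s).re
        simp only [sub_re] at h2 h3
        linarith
      simp only [norm_mul, norm_cexp_neg_mul_ofReal, norm_neg, norm_real,
        Real.norm_of_nonneg hv, ← mul_assoc]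
      refine mul_le_mul_of_nonneg_right ?_ (norm_nonneg _)
      -- `v ≤ δ⁻¹ exp (δ v)`
      have h4 : v ≤ δ⁻¹ * Real.exp (δ * v) := by
        rw [inv_mul_eq_div, le_div_iff₀ hδ0]
        linarith [Real.add_one_le_exp (δ * v)]
      calc Real.exp (-w.re * v) * v ≤ Real.exp (-w.re * v) * (δ⁻¹ * Real.exp (δ * v)) := by gcongr
        _ = δ⁻¹ * Real.exp (-w.re * v + δ * v) := by rw [Real.exp_add]; ring
        _ ≤ δ⁻¹ * Real.exp (-z.re * v) := by
          have : δ + δ = s.re - z.re := by simp only [hδ]; ring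
          have h5 : -w.re * v + δ * v ≤ -z.re * v := by
            rw [← add_mul]
            exact mul_le_mul_of_nonneg_right (by linarith) hv
          gcongr
  · have h1 : HasDerivAt (fun w : ℂ => -w * (v : ℂ)) (-1 * (v : ℂ)) w :=
      (hasDerivAt_neg w).mul_const _
    have := (h1.cexp).mul_const (f v)
    simpa using this

/-- On functions vanishing on the negative half-line, a weighted `L²` bound controls the
weighted `L¹` norm for every larger exponent. -/
theorem integrable_exp_mul_of_sq {f : ℝ → ℂ} {r x : ℝ} (hm : AEStronglyMeasurable f)
    (hf : ∀ v ≤ 0, f v = 0) (h2 : MemLp (fun v : ℝ => cexp (-r * v) * f v) 2) (hx : r < x) :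
    Integrable fun v : ℝ => cexp (-x * v) * f v := by
  have h3 : Integrable (fun v : ℝ => ‖cexp (-r * v) * f v‖ ^ 2) :=
    (memLp_two_iff_integrable_sq_norm h2.1).1 h2
  have h4 : Integrable ((Set.Ioi 0).indicator fun v : ℝ => Real.exp (-(2 * (x - r)) * v)) :=
    (integrableOn_exp_mul_Ioi (by linarith) 0).integrable_indicator measurableSet_Ioi
  refine (h3.add h4).mono' ((Continuous.aestronglyMeasurable (by fun_prop)).mul hm)
    (Eventually.of_forall fun v => ?_)
  rcases le_or_gt v 0 with hv | hv
  · simp [hf v hv, hv]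
  · simp only [Pi.add_apply, Set.indicator_of_mem (Set.mem_Ioi.2 hv)]
    have e1 : ‖cexp (-x * v) * f v‖ = ‖cexp (-r * v) * f v‖ * Real.exp (-(x - r) * v) := by
      have := norm_cexp_neg_mul_ofReal x v
      have h' := norm_cexp_neg_mul_ofReal r v
      rw [norm_mul, norm_mul, this, h', mul_right_comm, ← Real.exp_add]
      simp only [ofReal_re]
      ring_nf
    have e2 : Real.exp (-(2 * (x - r)) * v) = Real.exp (-(x - r) * v) ^ 2 := by
      rw [← Real.exp_nat_mul]
      push_cast
      ring_nf
    rw [e1, e2]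
    nlinarith [sq_nonneg (‖cexp (-r * v) * f v‖ - Real.exp (-(x - r) * v)),
      sq_nonneg (‖cexp (-r * v) * f v‖), sq_nonneg (Real.exp (-(x - r) * v))]

/-- The Laplace transform of a function in weighted `L²` has uniformly bounded `L²` norms on the
vertical lines of the half-plane. -/
theorem lintegral_enorm_laplace_sq_le {f : ℝ → ℂ} {r x : ℝ} (hm : AEStronglyMeasurable f)
    (hf : ∀ v ≤ 0, f v = 0) (h2 : MemLp (fun v : ℝ => cexp (-r * v) * f v) 2) (hx : r < x) :
    ∫⁻ t : ℝ, ‖laplace f (x + t * I)‖ₑ ^ 2 ≤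
      ENNReal.ofReal (2 * Real.pi) * ∫⁻ v : ℝ, ‖cexp (-r * v) * f v‖ₑ ^ 2 := by
  have hle : ∀ v : ℝ, ‖cexp (-x * v) * f v‖ ≤ ‖cexp (-r * v) * f v‖ := fun v => by
    rcases le_or_gt v 0 with hv | hv
    · simp [hf v hv]
    · have := norm_cexp_neg_mul_ofReal x v
      have h' := norm_cexp_neg_mul_ofReal r v
      rw [norm_mul, norm_mul, this, h']
      simp only [ofReal_re]
      gcongr
  rw [lintegral_enorm_laplace_sq (integrable_exp_mul_of_sq hm hf h2 hx)
    (h2.mono ((Continuous.aestronglyMeasurable (by fun_prop)).mul hm)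
      (Eventually.of_forall hle))]
  gcongr with v
  exact enorm_le_iff_norm_le.2 (hle v)

/-! ### The Mellin transform of the weight -/

theorem image_exp_neg_univ : (fun v : ℝ => Real.exp (-v)) '' Set.univ = Set.Ioi 0 := by
  rw [Set.image_univ, ← Real.range_exp]
  exact neg_surjective.range_comp Real.exp

theorem hasDerivAt_exp_neg (v : ℝ) :
    HasDerivAt (fun v : ℝ => Real.exp (-v)) (-Real.exp (-v)) v := by
  simpa using (hasDerivAt_neg v).exp

theorem injOn_exp_neg : Set.InjOn (fun v : ℝ => Real.exp (-v)) Set.univ := fun a _ b _ h => by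
  simpa using h

theorem abs_deriv_smul_cpow (f : ℝ → ℂ) (s : ℂ) (v : ℝ) :
    |-Real.exp (-v)| • (((Real.exp (-v) : ℝ) : ℂ) ^ (s - 1) • f (Real.exp (-v))) =
      cexp (-s * v) * f (Real.exp (-v)) := by
  rw [abs_neg, abs_of_pos (Real.exp_pos _), real_smul, smul_eq_mul, ← mul_assoc,
    cpow_def_of_ne_zero (by exact_mod_cast (Real.exp_pos _).ne'),
    ← ofReal_log (Real.exp_pos _).le, Real.log_exp, ofReal_exp, ← Complex.exp_add]
  congr 2
  push_cast
  ring

/-- The Mellin transform is the Laplace transform in the variable `v = -log x`. -/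
theorem mellin_eq_laplace (f : ℝ → ℂ) (s : ℂ) :
    mellin f s = laplace (fun v => f (Real.exp (-v))) s := by
  rw [mellin, ← image_exp_neg_univ, integral_image_eq_integral_abs_deriv_smul MeasurableSet.univ
    (fun v _ => (hasDerivAt_exp_neg v).hasDerivWithinAt) injOn_exp_neg, Measure.restrict_univ]
  exact integral_congr_ae (Eventually.of_forall fun v => abs_deriv_smul_cpow f s v)

theorem mellinConvergent_iff_integrable (f : ℝ → ℂ) (s : ℂ) :
    MellinConvergent f s ↔ Integrable fun v : ℝ => cexp (-s * v) * f (Real.exp (-v)) := by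
  rw [MellinConvergent, ← image_exp_neg_univ, integrableOn_image_iff_integrableOn_abs_deriv_smul
    MeasurableSet.univ (fun v _ => (hasDerivAt_exp_neg v).hasDerivWithinAt) injOn_exp_neg,
    integrableOn_univ]
  simp only [abs_deriv_smul_cpow]

section

variable {φ : ℝ → ℂ} {σ₀ : ℝ}

theorem IsWeight.eq_zero_of_one_lt (hφ : IsWeight φ σ₀) {x : ℝ} (hx : 1 < x) : φ x = 0 := by
  by_contra h
  exact absurd (hφ.support_subset h).2 (not_le.2 hx)

theorem IsWeight.integrableOn_Ioi (hφ : IsWeight φ σ₀) {c : ℝ} (hc : 0 < c) :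
    IntegrableOn φ (Set.Ioi c) := by
  obtain ⟨σ₁, hσ₁, hO⟩ := hφ.isBigO_one
  obtain ⟨C, hC0, hC⟩ := hO.exists_nonneg
  rw [Asymptotics.isBigOWith_iff] at hC
  obtain ⟨b, hb1, hb⟩ := mem_nhdsLT_iff_exists_Ioo_subset.1 hC
  have hb1' : b < 1 := hb1
  obtain ⟨d, hbd, hd1⟩ := exists_between (max_lt hb1' one_pos)
  obtain ⟨B, hB⟩ := hφ.locally_bounded (Set.Icc c d) isCompact_Icc fun x hx =>
    ⟨hc.trans_le hx.1, hx.2.trans_lt hd1⟩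
  have hI : IntegrableOn (fun x : ℝ => |B| + C * (1 - x) ^ (-σ₁)) (Set.Ioo c 1) := by
    rcases le_or_gt 1 c with h | h
    · simp [Set.Ioo_eq_empty_of_le h]
    have h1 : IntervalIntegrable (fun x : ℝ => x ^ (-σ₁)) volume 0 (1 - c) :=
      intervalIntegral.intervalIntegrable_rpow' (by linarith)
    have h2 := (h1.comp_sub_left 1).symm
    simp only [sub_sub_cancel, sub_zero] at h2
    have h3 := ((intervalIntegrable_const (c := |B|)).add (h2.const_mul C))
    exact ((intervalIntegrable_iff_integrableOn_Ioc_of_le h.le).1 h3).mono_set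
      Set.Ioo_subset_Ioc_self
  have hmid : IntegrableOn φ (Set.Ioo c 1) := by
    refine Integrable.mono' hI hφ.measurable.aestronglyMeasurable.restrict ?_
    refine (ae_restrict_iff' measurableSet_Ioo).2 (Eventually.of_forall fun x hx => ?_)
    have hpos : 0 ≤ C * (1 - x) ^ (-σ₁) :=
      mul_nonneg hC0 (Real.rpow_nonneg (by linarith [hx.2]) _)
    rcases le_or_gt x d with h | h
    · linarith [hB x ⟨hx.1.le, h⟩, le_abs_self B]
    · have : ‖φ x‖ ≤ C * ‖(1 - x) ^ (-σ₁)‖ :=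
        hb ⟨((le_max_left _ _).trans_lt hbd).trans h, hx.2⟩
      rw [Real.norm_of_nonneg (Real.rpow_nonneg (by linarith [hx.2]) _)] at this
      linarith [abs_nonneg B]
  have hout : IntegrableOn φ (Set.Ioi 1) :=
    integrableOn_zero.congr_fun (fun x hx => (hφ.eq_zero_of_one_lt hx).symm) measurableSet_Ioi
  have hpt : IntegrableOn φ {1} := by simp
  refine ((hmid.union hpt).union hout).mono_set fun x hx => ?_
  rcases lt_trichotomy x 1 with h | h | h
  · exact Or.inl (Or.inl ⟨hx, h⟩)
  · exact Or.inl (Or.inr h)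
  · exact Or.inr h

theorem IsWeight.locallyIntegrableOn (hφ : IsWeight φ σ₀) :
    LocallyIntegrableOn φ (Set.Ioi 0) := fun x hx => by
  refine ⟨Set.Ioi (x / 2), mem_nhdsWithin_of_mem_nhds (Ioi_mem_nhds ?_), ?_⟩
  · exact half_lt_self hx
  · exact hφ.integrableOn_Ioi (half_pos hx)

theorem IsWeight.isBigO_top (hφ : IsWeight φ σ₀) (b : ℝ) : φ =O[atTop] fun x : ℝ => x ^ (-b) := by
  refine (Asymptotics.isBigO_zero (E' := ℂ) _ _).congr' ?_ EventuallyEq.rfl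
  filter_upwards [eventually_gt_atTop 1] with x hx
  exact (hφ.eq_zero_of_one_lt hx).symm

theorem IsWeight.mellinConvergent (hφ : IsWeight φ σ₀) {s : ℂ} (hs : σ₀ < s.re) :
    MellinConvergent φ s :=
  mellinConvergent_of_isBigO_rpow hφ.locallyIntegrableOn (hφ.isBigO_top (s.re + 1))
    (by linarith) hφ.isBigO_zero hs

theorem IsWeight.differentiableOn_mellin (hφ : IsWeight φ σ₀) :
    DifferentiableOn ℂ (mellin φ) (halfPlane σ₀) := fun s hs =>
  (mellin_differentiableAt_of_isBigO_rpow hφ.locallyIntegrableOn (hφ.isBigO_top (s.re + 1))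
    (by linarith) hφ.isBigO_zero hs).differentiableWithinAt

/-! ### Laplace transform of the Dirichlet sums -/

/-- The sum over `1 ≤ n < e ^ v` occurring in `psi`, in the logarithmic variable `v`. -/
noncomputable def logSum (a : ℕ → ℂ) (φ : ℝ → ℂ) (v : ℝ) : ℂ :=
  ∑ n ∈ Finset.Ico 1 ⌈Real.exp v⌉₊, a n * φ (n / Real.exp v)

theorem logSum_eq_zero (a : ℕ → ℂ) (φ : ℝ → ℂ) {v : ℝ} (hv : v ≤ 0) : logSum a φ v = 0 := by
  have : ⌈Real.exp v⌉₊ ≤ 1 := by simpa [Nat.ceil_le] using hv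
  rw [logSum, Finset.Ico_eq_empty (by omega), Finset.sum_empty]

/-- Away from the countable set of logarithms of integers, `logSum` is a series of translates
of `v ↦ φ (e ^ (-v))`. -/
theorem IsWeight.hasSum_logSum (hφ : IsWeight φ σ₀) (a : ℕ → ℂ) :
    ∀ᵐ v : ℝ, HasSum (fun n : ℕ => a (n + 1) * φ (Real.exp (-(v - Real.log (n + 1)))))
      (logSum a φ v) := by
  have hc : (Set.range fun n : ℕ => Real.log (n + 1)).Countable := Set.countable_range _
  filter_upwards [hc.ae_notMem volume] with v hv
  have harg : ∀ n : ℕ, Real.exp (-(v - Real.log (n + 1))) = ((n + 1 : ℕ) : ℝ) / Real.exp v := by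
    intro n
    rw [neg_sub, Real.exp_sub, Real.exp_log (by positivity)]
    push_cast
    rfl
  simp_rw [harg]
  have h1 : logSum a φ v = ∑ n ∈ Finset.range (⌈Real.exp v⌉₊ - 1),
      a (n + 1) * φ (((n + 1 : ℕ) : ℝ) / Real.exp v) := by
    rw [logSum, Finset.sum_Ico_eq_sum_range]
    refine Finset.sum_congr rfl fun n _ => ?_
    rw [add_comm 1 n]
  rw [h1]
  refine hasSum_sum_of_ne_finset_zero fun n hn => ?_
  have h2 : ⌈Real.exp v⌉₊ ≤ n + 1 := by
    rw [Finset.mem_range, not_lt] at hn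
    omega
  have h3 : Real.exp v ≤ ((n + 1 : ℕ) : ℝ) := Nat.ceil_le.1 h2
  -- the value `φ 1` may be nonzero, hence the exceptional set `e ^ v = n + 1`
  have h4 : Real.exp v ≠ ((n + 1 : ℕ) : ℝ) := fun h => hv ⟨n, by
    have := congrArg Real.log h
    rw [Real.log_exp] at this
    simp [this]⟩
  rw [hφ.eq_zero_of_one_lt ((one_lt_div (Real.exp_pos _)).2 (lt_of_le_of_ne h3 h4)), mul_zero]

theorem IsWeight.aestronglyMeasurable_exp_neg (hφ : IsWeight φ σ₀) :
    AEStronglyMeasurable fun v : ℝ => φ (Real.exp (-v)) :=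
  aestronglyMeasurable_of_exp_mul (s := ((σ₀ + 1 : ℝ) : ℂ))
    ((mellinConvergent_iff_integrable φ _).1 (hφ.mellinConvergent (by simp))).1

theorem IsWeight.aestronglyMeasurable_logSum (hφ : IsWeight φ σ₀) (a : ℕ → ℂ) :
    AEStronglyMeasurable (logSum a φ) := by
  refine aestronglyMeasurable_of_tendsto_ae atTop (f := fun N (v : ℝ) =>
    ∑ n ∈ Finset.range N, a (n + 1) * φ (Real.exp (-(v - Real.log (n + 1))))) (fun N => ?_) ?_
  · refine Finset.aestronglyMeasurable_fun_sum _ fun n _ => AEStronglyMeasurable.const_mul ?_ _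
    exact hφ.aestronglyMeasurable_exp_neg.comp_quasiMeasurePreserving
      (measurePreserving_sub_right volume (Real.log (n + 1))).quasiMeasurePreserving
  · filter_upwards [hφ.hasSum_logSum a] with v hv using hv.tendsto_sum_nat

/-- The Laplace transform of the Dirichlet sums is the product of the Dirichlet series and the
Mellin transform of the weight. -/
theorem IsWeight.laplace_logSum (hφ : IsWeight φ σ₀) {a : ℕ → ℂ} {s : ℂ} (hs : σ₀ < s.re)
    (ha : LSeriesSummable a s) : laplace (logSum a φ) s = LSeries a s * mellin φ s := by
  have hI := (mellinConvergent_iff_integrable φ s).1 (hφ.mellinConvergent hs)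
  set G : ℝ → ℂ := fun v => cexp (-s * v) * φ (Real.exp (-v)) with hG
  have hterm : ∀ (n : ℕ) (v : ℝ),
      cexp (-s * v) * (a (n + 1) * φ (Real.exp (-(v - Real.log (n + 1))))) =
        LSeries.term a s (n + 1) * G (v - Real.log (n + 1)) := by
    intro n v
    have h0 : ((n + 1 : ℕ) : ℂ) ≠ 0 := by exact_mod_cast n.succ_ne_zero
    have h1 : cexp (-s * v) =
        (((n + 1 : ℕ) : ℂ) ^ s)⁻¹ * cexp (-s * (v - Real.log (n + 1) : ℝ)) := by
      rw [cpow_def_of_ne_zero h0, ← Complex.exp_neg, ← Complex.exp_add, ← natCast_log]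
      congr 1
      push_cast
      ring
    rw [LSeries.term_of_ne_zero n.succ_ne_zero, h1, hG, div_eq_mul_inv]
    ring
  have hint : ∀ n : ℕ, Integrable fun v : ℝ =>
      cexp (-s * v) * (a (n + 1) * φ (Real.exp (-(v - Real.log (n + 1))))) := fun n => by
    simp_rw [hterm]
    exact (hI.comp_sub_right _).const_mul _
  have hsum : Summable fun n : ℕ => ∫ v : ℝ,
      ‖cexp (-s * v) * (a (n + 1) * φ (Real.exp (-(v - Real.log (n + 1)))))‖ := by
    have e : ∀ n : ℕ, ∫ v : ℝ,
        ‖cexp (-s * v) * (a (n + 1) * φ (Real.exp (-(v - Real.log (n + 1)))))‖ =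
        ‖LSeries.term a s (n + 1)‖ * ∫ v : ℝ, ‖G v‖ := fun n => by
      simp_rw [hterm, norm_mul]
      rw [integral_const_mul, integral_sub_right_eq_self (fun v => ‖G v‖)]
    simp_rw [e]
    exact ((summable_nat_add_iff 1).2 ha.norm).mul_right _
  have key := (hasSum_integral_of_summable_integral_norm hint hsum).tsum_eq
  have e2 : ∫ v : ℝ, (∑' n : ℕ,
      cexp (-s * v) * (a (n + 1) * φ (Real.exp (-(v - Real.log (n + 1)))))) =
      laplace (logSum a φ) s := by
    refine integral_congr_ae ?_
    filter_upwards [hφ.hasSum_logSum a] with v hv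
    exact (hv.mul_left _).tsum_eq
  have e3 : ∀ n : ℕ, ∫ v : ℝ,
      cexp (-s * v) * (a (n + 1) * φ (Real.exp (-(v - Real.log (n + 1))))) =
      LSeries.term a s (n + 1) * mellin φ s := fun n => by
    simp_rw [hterm]
    rw [integral_const_mul, integral_sub_right_eq_self G, mellin_eq_laplace]
    rfl
  rw [← e2, ← key]
  simp_rw [e3]
  rw [tsum_mul_right, LSeries, ha.tsum_eq_zero_add, LSeries.term_zero, zero_add]

end

theorem IsDirichletContinuation.lseriesSummable {a : ℕ → ℂ} {L : ℂ → ℂ} {σ₀ : ℝ} {m : ℕ}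
    (hL : IsDirichletContinuation a L σ₀ m) {s : ℂ} (hs : 1 < s.re) : LSeriesSummable a s := by
  refine LSeriesSummable_of_isBigO_rpow (x := (1 + s.re) / 2) (by linarith) ?_
  exact hL.coeff_isBigO _ (by linarith)

/-! ### The residue at the pole and its Laplace transform -/

/-- The residue of `G(z) / (z - z₀) ^ (n + 1)` at `z₀` is the `n`-th Taylor coefficient of `G`. -/
theorem residue_eq_iteratedDeriv {f G : ℂ → ℂ} {z₀ : ℂ} {n : ℕ} (hG : AnalyticAt ℂ G z₀)
    (hf : ∀ᶠ z in 𝓝[≠] z₀, f z = (1 / (z - z₀) ^ (n + 1)) * G z) :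
    residue f z₀ = iteratedDeriv n G z₀ / n.factorial := by
  have h1 : ∀ᶠ z in 𝓝 z₀, z ≠ z₀ → f z = (1 / (z - z₀) ^ (n + 1)) * G z :=
    eventually_nhdsWithin_iff.1 hf
  obtain ⟨ε, hε, hball⟩ := Metric.eventually_nhds_iff_ball.1
    (h1.and (hG.eventually_analyticAt))
  refine Tendsto.limUnder_eq (tendsto_const_nhds.congr' ?_)
  filter_upwards [Ioo_mem_nhdsGT hε] with ρ hρ
  have hsub : Metric.closedBall z₀ ρ ⊆ Metric.ball z₀ ε := Metric.closedBall_subset_ball hρ.2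
  have hd : DifferentiableOn ℂ G (Metric.closedBall z₀ ρ) := fun z hz =>
    (hball z (hsub hz)).2.differentiableAt.differentiableWithinAt
  have hC := hd.circleIntegral_one_div_sub_center_pow_smul hρ.1 n
  have hcongr : ∮ z in C(z₀, ρ), f z = ∮ z in C(z₀, ρ), (1 / (z - z₀) ^ (n + 1)) • G z := by
    refine circleIntegral.integral_congr hρ.1.le fun z hz => ?_
    exact (hball z (hsub (Metric.sphere_subset_closedBall hz))).1
      (Metric.ne_of_mem_sphere hz hρ.1.ne')
  rw [hcongr, hC, smul_eq_mul]
  have := two_pi_I_ne_zero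
  field_simp

/-- The residue at `s = 1` of `M(s) (s - 1) ^ (-(n + 1)) e ^ (v s)` as a function of `v`, for `M`
holomorphic near `1`: a polynomial in `v` times `e ^ v`. -/
noncomputable def logResidue (M : ℂ → ℂ) (n : ℕ) (v : ℝ) : ℂ :=
  ∑ i ∈ Finset.range (n + 1), iteratedDeriv i M 1 / i.factorial *
    ((v : ℂ) ^ (n - i) * cexp v / (n - i).factorial)

/-- Leibniz' rule for the `n`-th derivative of `M(z) e ^ (v z)` gives the residue. -/
theorem residue_mul_cpow {f M : ℂ → ℂ} {n : ℕ} (hM : AnalyticAt ℂ M 1)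
    (hf : ∀ᶠ z in 𝓝[≠] 1, f z = (1 / (z - 1) ^ (n + 1)) * M z) (v : ℝ) :
    residue (fun z => f z * ((Real.exp v : ℝ) : ℂ) ^ z) 1 = logResidue M n v := by
  have hE : ∀ z : ℂ, ((Real.exp v : ℝ) : ℂ) ^ z = cexp (v * z) := fun z => by
    rw [cpow_def_of_ne_zero (by exact_mod_cast (Real.exp_pos v).ne'),
      ← ofReal_log (Real.exp_pos _).le, Real.log_exp]
  have hEa : AnalyticAt ℂ (fun z : ℂ => cexp (v * z)) 1 := by fun_prop
  rw [residue_eq_iteratedDeriv (n := n) (hM.mul hEa), iteratedDeriv_mul hM.contDiffAt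
    hEa.contDiffAt, logResidue, Finset.sum_div]
  · refine Finset.sum_congr rfl fun i hi => ?_
    have hi' : i ≤ n := Nat.lt_succ_iff.1 (Finset.mem_range.1 hi)
    rw [iteratedDeriv_cexp_const_mul, Nat.cast_choose ℂ hi']
    simp only [mul_one]
    have h1 : (i.factorial : ℂ) ≠ 0 := by exact_mod_cast i.factorial_ne_zero
    have h2 : (n.factorial : ℂ) ≠ 0 := by exact_mod_cast n.factorial_ne_zero
    have h3 : ((n - i).factorial : ℂ) ≠ 0 := by exact_mod_cast (n - i).factorial_ne_zero
    field_simp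
  · filter_upwards [hf] with z hz
    rw [hz, hE, Pi.mul_apply, mul_assoc]

theorem laplace_pow_mul_exp (k : ℕ) {x : ℝ} (hx : 1 < x) :
    Integrable (fun v : ℝ => cexp (-x * v) *
      (Set.Ioi (0 : ℝ)).indicator (fun v : ℝ => (v : ℂ) ^ k * cexp v / k.factorial) v) ∧
    laplace ((Set.Ioi (0 : ℝ)).indicator (fun v : ℝ => (v : ℂ) ^ k * cexp v / k.factorial)) x =
      1 / ((x : ℂ) - 1) ^ (k + 1) := by
  have hx1 : 0 < x - 1 := by linarith
  have hval := Real.integral_rpow_mul_exp_neg_mul_Ioi (a := (k : ℝ) + 1) (by positivity) hx1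
  rw [Real.Gamma_nat_eq_factorial] at hval
  simp only [add_sub_cancel_right, Real.rpow_natCast] at hval
  -- a Bochner integral with nonzero value is convergent
  have hI : IntegrableOn (fun t : ℝ => t ^ k * Real.exp (-((x - 1) * t))) (Set.Ioi 0) := by
    refine not_imp_comm.1 integral_undef ?_
    rw [hval]
    positivity
  have e : (fun v : ℝ => cexp (-x * v) *
      (Set.Ioi (0 : ℝ)).indicator (fun v : ℝ => (v : ℂ) ^ k * cexp v / k.factorial) v) =
      (Set.Ioi (0 : ℝ)).indicator (fun t : ℝ =>
        ((t ^ k * Real.exp (-((x - 1) * t)) / k.factorial : ℝ) : ℂ)) := by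
    funext v
    by_cases hv : v ∈ Set.Ioi (0 : ℝ)
    · rw [Set.indicator_of_mem hv, Set.indicator_of_mem hv]
      push_cast
      rw [show (-(((x : ℂ) - 1) * v)) = -x * v + v by ring, Complex.exp_add]
      ring
    · simp [Set.indicator_of_notMem hv]
  have hI2 : IntegrableOn (fun t : ℝ =>
      ((t ^ k * Real.exp (-((x - 1) * t)) / k.factorial : ℝ) : ℂ)) (Set.Ioi 0) :=
    (hI.div_const _).ofReal
  constructor
  · rw [e]
    exact hI2.integrable_indicator measurableSet_Ioi
  · rw [laplace]
    simp only [funext_iff] at e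
    simp_rw [e]
    rw [integral_indicator measurableSet_Ioi, integral_complex_ofReal, integral_div, hval]
    have h1 : (k.factorial : ℝ) ≠ 0 := by exact_mod_cast k.factorial_ne_zero
    rw [← Nat.cast_succ, Real.rpow_natCast, mul_div_assoc, div_self h1]
    push_cast
    simp

theorem laplace_logResidue (M : ℂ → ℂ) (n : ℕ) {x : ℝ} (hx : 1 < x) :
    Integrable (fun v : ℝ => cexp (-x * v) * (Set.Ioi (0 : ℝ)).indicator (logResidue M n) v) ∧
    laplace ((Set.Ioi (0 : ℝ)).indicator (logResidue M n)) x =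
      ∑ i ∈ Finset.range (n + 1),
        iteratedDeriv i M 1 / i.factorial * (1 / ((x : ℂ) - 1) ^ (n - i + 1)) := by
  have e : (fun v : ℝ => cexp (-x * v) * (Set.Ioi (0 : ℝ)).indicator (logResidue M n) v) =
      fun v : ℝ => ∑ i ∈ Finset.range (n + 1), iteratedDeriv i M 1 / i.factorial *
        (cexp (-x * v) * (Set.Ioi (0 : ℝ)).indicator
          (fun v : ℝ => (v : ℂ) ^ (n - i) * cexp v / (n - i).factorial) v) := by
    funext v
    by_cases hv : v ∈ Set.Ioi (0 : ℝ)
    · simp only [Set.indicator_of_mem hv, logResidue, Finset.mul_sum]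
      exact Finset.sum_congr rfl fun i _ => by ring
    · simp [Set.indicator_of_notMem hv]
  have hint : ∀ i ∈ Finset.range (n + 1), Integrable fun v : ℝ =>
      iteratedDeriv i M 1 / i.factorial * (cexp (-x * v) * (Set.Ioi (0 : ℝ)).indicator
          (fun v : ℝ => (v : ℂ) ^ (n - i) * cexp v / (n - i).factorial) v) := fun i _ =>
    (laplace_pow_mul_exp (n - i) hx).1.const_mul _
  constructor
  · rw [e]
    exact integrable_finsetSum _ hint
  · rw [laplace, e, integral_finsetSum _ hint]
    refine Finset.sum_congr rfl fun i _ => ?_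
    rw [integral_const_mul, ← (laplace_pow_mul_exp (n - i) hx).2]
    rfl

/-! ### The functional identity -/

/-- The function `s ↦ (s - 1) ^ m * L s` extends holomorphically to the whole half-plane. -/
theorem IsDirichletContinuation.exists_regular {a : ℕ → ℂ} {L : ℂ → ℂ} {σ₀ : ℝ} {m : ℕ}
    (hL : IsDirichletContinuation a L σ₀ m) :
    ∃ N : ℂ → ℂ, DifferentiableOn ℂ N (halfPlane σ₀) ∧ ∀ s, s ≠ 1 → N s = (s - 1) ^ m * L s := by
  obtain ⟨g, hg, -, hgL⟩ := (meromorphicOrderAt_eq_int_iff hL.meromorphicAt_one).1 hL.pole_order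
  refine ⟨Function.update (fun s => (s - 1) ^ m * L s) 1 (g 1), fun s hs => ?_,
    fun s hs => Function.update_of_ne hs _ _⟩
  refine DifferentiableAt.differentiableWithinAt ?_
  rcases eq_or_ne s 1 with rfl | hs1
  · refine hg.differentiableAt.congr_of_eventuallyEq ?_
    filter_upwards [eventually_nhdsWithin_iff.1 hgL] with z hz
    rcases eq_or_ne z 1 with rfl | hz1
    · simp
    · have h1 : z - 1 ≠ 0 := sub_ne_zero.2 hz1
      rw [Function.update_of_ne hz1, hz hz1, smul_eq_mul, zpow_neg, zpow_natCast, ← mul_assoc,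
        mul_inv_cancel₀ (pow_ne_zero _ h1), one_mul]
  · have h1 : DifferentiableAt ℂ (fun s => (s - 1) ^ m * L s) s :=
      DifferentiableAt.mul (by fun_prop) (hL.analytic s ⟨hs, hs1⟩).differentiableAt
    refine h1.congr_of_eventuallyEq ?_
    filter_upwards [isOpen_ne.mem_nhds hs1] with z hz
    exact Function.update_of_ne hz _ _

/-- The function `v ↦ ψ (e ^ v)`, cut off to `v > 0`. -/
noncomputable def logPsi (a : ℕ → ℂ) (L : ℂ → ℂ) (φ : ℝ → ℂ) : ℝ → ℂ :=
  (Set.Ioi (0 : ℝ)).indicator fun v => psi a L φ (Real.exp v)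

theorem logPsi_eq_zero (a : ℕ → ℂ) (L : ℂ → ℂ) (φ : ℝ → ℂ) {v : ℝ} (hv : v ≤ 0) :
    logPsi a L φ v = 0 := Set.indicator_of_notMem (by simpa using hv) _

theorem logPsi_eq {a : ℕ → ℂ} {L M : ℂ → ℂ} {φ : ℝ → ℂ} {n : ℕ} (hM : AnalyticAt ℂ M 1)
    (hf : ∀ᶠ z in 𝓝[≠] 1, L z * mellin φ z = (1 / (z - 1) ^ (n + 1)) * M z) (v : ℝ) :
    logPsi a L φ v = (Set.Ioi (0 : ℝ)).indicator (logResidue M n) v - logSum a φ v := by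
  by_cases hv : v ∈ Set.Ioi (0 : ℝ)
  · rw [logPsi, Set.indicator_of_mem hv, Set.indicator_of_mem hv, psi, residue_mul_cpow hM hf]
    rfl
  · rw [logPsi, Set.indicator_of_notMem hv, Set.indicator_of_notMem hv,
      logSum_eq_zero a φ (not_lt.1 hv), sub_zero]

/-- The integrability condition on `ψ` in the variable `v = log t`. -/
theorem memLp_logPsi {a : ℕ → ℂ} {L : ℂ → ℂ} {φ : ℝ → ℂ} {r : ℝ} (h : PsiCondition a L φ r)
    (hm : AEStronglyMeasurable (logPsi a L φ)) :
    MemLp (fun v : ℝ => cexp (-r * v) * logPsi a L φ v) 2 := by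
  refine (memLp_two_iff_integrable_sq_norm
    ((Continuous.aestronglyMeasurable (by fun_prop)).mul hm)).2 ?_
  have himg : Real.exp '' Set.Ioi 0 = Set.Ioi 1 := by
    ext y
    simp only [Set.mem_image, Set.mem_Ioi]
    constructor
    · rintro ⟨x, hx, rfl⟩
      simpa using hx
    · intro hy
      exact ⟨Real.log y, Real.log_pos hy, Real.exp_log (by linarith)⟩
  have h2 := h.2
  rw [← himg, integrableOn_image_iff_integrableOn_abs_deriv_smul measurableSet_Ioi
    (fun v _ => (Real.hasDerivAt_exp v).hasDerivWithinAt) Real.exp_injective.injOn] at h2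
  refine (h2.integrable_indicator measurableSet_Ioi).congr (Eventually.of_forall fun v => ?_)
  by_cases hv : v ∈ Set.Ioi (0 : ℝ)
  · have hn := norm_cexp_neg_mul_ofReal r v
    simp only [logPsi, Pi.mul_apply, Set.indicator_of_mem hv]
    rw [norm_mul, hn, mul_pow, abs_of_pos (Real.exp_pos _), smul_eq_mul,
      ← Real.exp_mul, mul_div_left_comm, ← Real.exp_sub, ← Real.exp_nat_mul, mul_comm]
    congr 2
    simp
    ring
  · simp [logPsi, Set.indicator_of_notMem hv]

section

variable {a : ℕ → ℂ} {L : ℂ → ℂ} {σ₀ : ℝ} {n : ℕ} {φ : ℝ → ℂ} {r₀ : ℝ} {N : ℂ → ℂ}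

theorem analyticAt_regular (hφ : IsWeight φ σ₀) (hσ₀ : σ₀ < 1)
    (hN : DifferentiableOn ℂ N (halfPlane σ₀)) :
    AnalyticAt ℂ (fun z => N z * mellin φ z) 1 :=
  (hN.mul hφ.differentiableOn_mellin).analyticAt
    ((isOpen_halfPlane σ₀).mem_nhds (by simpa [halfPlane] using hσ₀))

theorem logPsi_eq_of_regular (hφ : IsWeight φ σ₀) (hσ₀ : σ₀ < 1)
    (hN : DifferentiableOn ℂ N (halfPlane σ₀))
    (hNL : ∀ s, s ≠ 1 → N s = (s - 1) ^ (n + 1) * L s) (v : ℝ) :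
    logPsi a L φ v = (Set.Ioi (0 : ℝ)).indicator (logResidue (fun z => N z * mellin φ z) n) v -
      logSum a φ v := by
  refine logPsi_eq (analyticAt_regular hφ hσ₀ hN) ?_ v
  filter_upwards [self_mem_nhdsWithin] with z hz
  have h1 : z - 1 ≠ 0 := sub_ne_zero.2 hz
  rw [hNL z hz]
  field_simp

theorem aestronglyMeasurable_logPsi (hφ : IsWeight φ σ₀) (hσ₀ : σ₀ < 1)
    (hN : DifferentiableOn ℂ N (halfPlane σ₀))
    (hNL : ∀ s, s ≠ 1 → N s = (s - 1) ^ (n + 1) * L s) :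
    AEStronglyMeasurable (logPsi a L φ) := by
  rw [funext (logPsi_eq_of_regular hφ hσ₀ hN hNL)]
  refine AEStronglyMeasurable.sub (AEStronglyMeasurable.indicator ?_ measurableSet_Ioi)
    (hφ.aestronglyMeasurable_logSum a)
  refine Continuous.aestronglyMeasurable ?_
  unfold logResidue
  fun_prop

/-- The functional identity behind the theorem: on the half-plane of `H²`-convergence, the Laplace
transform of `ψ (e ^ v)` is the difference of the principal part of `L φ̂` at `1` and of `L φ̂`
itself. Here the identity is multiplied by `(s - 1) ^ (n + 1)`. -/
theorem regular_eq_taylor_sub_laplace (hL : IsDirichletContinuation a L σ₀ (n + 1))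
    (hφ : IsWeight φ σ₀) (hσr₀ : σ₀ < r₀) (hr₀1 : r₀ < 1)
    (hN : DifferentiableOn ℂ N (halfPlane σ₀))
    (hNL : ∀ s, s ≠ 1 → N s = (s - 1) ^ (n + 1) * L s)
    (hψ : MemLp (fun v : ℝ => cexp (-r₀ * v) * logPsi a L φ v) 2) {s : ℂ}
    (hs : s ∈ halfPlane r₀) :
    N s * mellin φ s = (∑ i ∈ Finset.range (n + 1),
      iteratedDeriv i (fun z => N z * mellin φ z) 1 / i.factorial * (s - 1) ^ i) -
        (s - 1) ^ (n + 1) * laplace (logPsi a L φ) s := by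
  set M : ℂ → ℂ := fun z => N z * mellin φ z with hMdef
  have hm := aestronglyMeasurable_logPsi (a := a) hφ hL.sigma_lt_one hN hNL
  have hMd : DifferentiableOn ℂ M (halfPlane r₀) :=
    (hN.mul hφ.differentiableOn_mellin).mono fun s hs => hσr₀.trans hs
  have hRd : DifferentiableOn ℂ (fun s : ℂ => (∑ i ∈ Finset.range (n + 1),
      iteratedDeriv i M 1 / i.factorial * (s - 1) ^ i) -
        (s - 1) ^ (n + 1) * laplace (logPsi a L φ) s) (halfPlane r₀) := by
    intro w hw
    obtain ⟨y, hy1, hy2⟩ := exists_between (show r₀ < w.re from hw)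
    have hd : DifferentiableAt ℂ (laplace (logPsi a L φ)) w :=
      differentiableAt_laplace (z := (y : ℂ))
        (integrable_exp_mul_of_sq hm (fun v hv => logPsi_eq_zero a L φ hv) hψ hy1)
        (fun v hv => logPsi_eq_zero a L φ hv.le) (by simpa using hy2)
    refine DifferentiableAt.differentiableWithinAt ?_
    fun_prop
  -- for real `x > 1` the identity is computed term by term, and it extends by the identity theorem
  have hreal : ∀ x : ℝ, 1 < x → M x = (∑ i ∈ Finset.range (n + 1),
      iteratedDeriv i M 1 / i.factorial * ((x : ℂ) - 1) ^ i) -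
        ((x : ℂ) - 1) ^ (n + 1) * laplace (logPsi a L φ) x := by
    intro x hx
    have hx1 : (x : ℂ) ≠ 1 := by exact_mod_cast hx.ne'
    have hx2 : (x : ℂ) - 1 ≠ 0 := sub_ne_zero.2 hx1
    obtain ⟨R1, R2⟩ := laplace_logResidue M n hx
    have hPi := integrable_exp_mul_of_sq hm (fun v hv => logPsi_eq_zero a L φ hv) hψ
      (hr₀1.trans hx)
    have hS : logSum a φ = fun v => (Set.Ioi (0 : ℝ)).indicator (logResidue M n) v -
        logPsi a L φ v := by
      funext v
      rw [logPsi_eq_of_regular hφ hL.sigma_lt_one hN hNL]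
      ring
    have h1 : laplace (logSum a φ) x = laplace ((Set.Ioi (0 : ℝ)).indicator (logResidue M n)) x -
        laplace (logPsi a L φ) x := by
      rw [hS, laplace, laplace, laplace, ← integral_sub R1 hPi]
      simp only [mul_sub]
    rw [hφ.laplace_logSum (by simpa using hL.sigma_lt_one.trans hx)
      (hL.lseriesSummable (by simpa using hx)), ← hL.eq_LSeries _ (by simpa using hx), R2] at h1
    have h2 : laplace (logPsi a L φ) x = (∑ i ∈ Finset.range (n + 1),
        iteratedDeriv i M 1 / i.factorial * (1 / ((x : ℂ) - 1) ^ (n - i + 1))) -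
        L x * mellin φ x := by rw [h1]; ring
    have h3 : ((x : ℂ) - 1) ^ (n + 1) * (∑ i ∈ Finset.range (n + 1),
        iteratedDeriv i M 1 / i.factorial * (1 / ((x : ℂ) - 1) ^ (n - i + 1))) =
        ∑ i ∈ Finset.range (n + 1), iteratedDeriv i M 1 / i.factorial * ((x : ℂ) - 1) ^ i := by
      rw [Finset.mul_sum]
      refine Finset.sum_congr rfl fun i hi => ?_
      have hi' : i ≤ n := Nat.lt_succ_iff.1 (Finset.mem_range.1 hi)
      rw [show n + 1 = i + (n - i + 1) by omega, pow_add]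
      field_simp
    rw [h2, mul_sub, h3, hMdef]
    simp only [hNL _ hx1]
    ring
  refine (hMd.analyticOnNhd (isOpen_halfPlane r₀)).eqOn_of_preconnected_of_frequently_eq
    (hRd.analyticOnNhd (isOpen_halfPlane r₀)) (convex_halfPlane r₀).isPreconnected
    (z₀ := ((2 : ℝ) : ℂ)) (by simp [halfPlane]; linarith) ?_ hs
  have ht : Tendsto (fun x : ℝ => (x : ℂ)) (𝓝[>] 2) (𝓝[≠] ((2 : ℝ) : ℂ)) := by
    refine tendsto_nhdsWithin_iff.2
      ⟨(continuous_ofReal.tendsto 2).mono_left nhdsWithin_le_nhds, ?_⟩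
    filter_upwards [self_mem_nhdsWithin] with x hx
    have hx' : (2 : ℝ) < x := hx
    simpa using (by exact_mod_cast hx'.ne' : (x : ℂ) ≠ (2 : ℂ))
  refine ht.frequently (Eventually.frequently ?_)
  filter_upwards [self_mem_nhdsWithin] with x hx
  have hx' : (2 : ℝ) < x := hx
  exact hreal x (by linarith)

end

/-! ### Membership of `h` in the Hardy space -/

theorem Seq.differentiable_g (A : Seq) : Differentiable ℂ A.g := by
  have : ∀ j, (A.α j : ℂ) ≠ 0 := fun j => by exact_mod_cast (A.α_mem j).1.ne'
  intro s
  unfold Seq.g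
  refine DifferentiableAt.fun_sum fun j _ => DifferentiableAt.const_mul ?_ _
  exact differentiableAt_id.const_cpow (Or.inl (this j))

theorem Seq.norm_g_le (A : Seq) {r : ℝ} {s : ℂ} (hs : r ≤ s.re) :
    ‖A.g s‖ ≤ ∑ j, ‖A.c j‖ * A.α j ^ r := by
  refine (norm_sum_le _ _).trans (Finset.sum_le_sum fun j _ => ?_)
  rw [norm_mul, norm_cpow_eq_rpow_re_of_pos (A.α_mem j).1]
  exact mul_le_mul_of_nonneg_left
    (Real.rpow_le_rpow_of_exponent_ge (A.α_mem j).1 (A.α_mem j).2 hs) (norm_nonneg _)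

theorem shift_mem_halfPlane {σ₀ r : ℝ} {s : ℂ} (hs : s ∈ halfPlane σ₀) :
    s + r - σ₀ ∈ halfPlane r := by
  have : σ₀ < s.re := hs
  simp only [halfPlane, Set.mem_ofPred_eq, sub_re, add_re, ofReal_re]
  linarith

theorem differentiableOn_regular_formula {N : ℂ → ℂ} {φ : ℝ → ℂ} {σ₀ r : ℝ} {m : ℕ} (A : Seq)
    (hφ : IsWeight φ σ₀) (hσr : σ₀ < r) (hr : r < 1) (hN : DifferentiableOn ℂ N (halfPlane σ₀)) :
    DifferentiableOn ℂ (fun s : ℂ => -(1 / (Real.sqrt (2 * Real.pi) : ℂ)) *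
      (N (s + r - σ₀) * mellin φ (s + r - σ₀) / (s + r - σ₀ + 1 - 2 * r) ^ m) *
        A.g (s + r - σ₀)) (halfPlane σ₀) := by
  have hsh : DifferentiableOn ℂ (fun s : ℂ => s + r - σ₀) (halfPlane σ₀) := by fun_prop
  have hmaps : Set.MapsTo (fun s : ℂ => s + r - σ₀) (halfPlane σ₀) (halfPlane σ₀) :=
    fun s hs => hσr.trans (shift_mem_halfPlane hs)
  refine (((hN.comp hsh hmaps).mul (hφ.differentiableOn_mellin.comp hsh hmaps)).div
    (by fun_prop) fun s hs => pow_ne_zero _ (ne_zero_of_re_pos ?_)).const_mul _ |>.mul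
    (A.differentiable_g.comp_differentiableOn hsh)
  have : σ₀ < s.re := hs
  simp
  linarith

/-- On the half-plane `h` is given by a formula without singularities, in terms of a
holomorphic function `N` which extends `(s - 1) ^ m * L s`. -/
theorem h_eq {L N : ℂ → ℂ} {φ : ℝ → ℂ} {σ₀ r : ℝ} {m : ℕ} (A : Seq) (hφ : IsWeight φ σ₀)
    (hσr : σ₀ < r) (hr : r < 1) (hN : DifferentiableOn ℂ N (halfPlane σ₀))
    (hNL : ∀ s, s ≠ 1 → N s = (s - 1) ^ m * L s) {s : ℂ} (hs : s ∈ halfPlane σ₀) :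
    h L φ σ₀ m A r s = -(1 / (Real.sqrt (2 * Real.pi) : ℂ)) *
      (N (s + r - σ₀) * mellin φ (s + r - σ₀) / (s + r - σ₀ + 1 - 2 * r) ^ m) *
        A.g (s + r - σ₀) := by
  have hoff : ∀ s : ℂ, s ≠ 1 - r + σ₀ → hFormula L φ σ₀ m A r s =
      -(1 / (Real.sqrt (2 * Real.pi) : ℂ)) *
      (N (s + r - σ₀) * mellin φ (s + r - σ₀) / (s + r - σ₀ + 1 - 2 * r) ^ m) *
        A.g (s + r - σ₀) := by
    intro s hs
    have hw : s + r - σ₀ ≠ 1 := fun h => hs (by linear_combination h)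
    rw [hFormula, blaschke, hNL _ hw, map_one, div_pow]
    ring
  rw [h]
  rcases eq_or_ne s (1 - r + σ₀) with rfl | hne
  · rw [Function.update_self]
    refine Tendsto.limUnder_eq ?_
    have hc := ((differentiableOn_regular_formula (m := m) A hφ hσr hr hN).differentiableAt
      ((isOpen_halfPlane σ₀).mem_nhds hs)).continuousAt.tendsto
    refine (hc.mono_left (nhdsWithin_le_nhds (s := {(1 - r + σ₀ : ℂ)}ᶜ))).congr' ?_
    filter_upwards [self_mem_nhdsWithin] with z hz
    exact (hoff z hz).symm
  · rw [Function.update_of_ne hne, hoff s hne]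

/-- The Blaschke factor of the point `1` has modulus at most one. -/
theorem norm_sub_one_le {r : ℝ} (hr : r < 1) {w : ℂ} (hw : w ∈ halfPlane r) :
    ‖w - 1‖ ≤ ‖w + 1 - 2 * r‖ := by
  have hw' : r < w.re := hw
  have hre : (w + 1 - 2 * r : ℂ).re = w.re + 1 - 2 * r := by simp
  rw [← sq_le_sq₀ (norm_nonneg _) (norm_nonneg _), ← normSq_eq_norm_sq, ← normSq_eq_norm_sq,
    normSq_apply, normSq_apply, hre]
  simp
  nlinarith

/-- On `Re w > r` a polynomial of degree at most `n`, divided by `(w + 1 - 2 r) ^ (n + 1)`, is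
of order `O(1 / |w + 1 - 2 r|)`. -/
theorem norm_taylor_div_le {r : ℝ} (hr : r < 1) (t : ℕ → ℂ) (n : ℕ) {w : ℂ}
    (hw : w ∈ halfPlane r) :
    ‖(∑ i ∈ Finset.range (n + 1), t i * (w - 1) ^ i) / (w + 1 - 2 * r) ^ (n + 1)‖ ≤
      (∑ i ∈ Finset.range (n + 1), ‖t i‖ / (1 - r) ^ (n - i)) / ‖w + 1 - 2 * r‖ := by
  have hw' : r < w.re := hw
  have hD : 0 < 1 - r := by linarith
  have hre : (w + 1 - 2 * r : ℂ).re = w.re + 1 - 2 * r := by simp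
  have hDp : 1 - r ≤ ‖w + 1 - 2 * r‖ := by
    refine le_trans ?_ (re_le_norm _)
    rw [hre]
    linarith
  have hp : 0 < ‖w + 1 - 2 * r‖ := hD.trans_le hDp
  have hwp := norm_sub_one_le hr hw
  rw [Finset.sum_div, Finset.sum_div]
  refine (norm_sum_le _ _).trans (Finset.sum_le_sum fun i hi => ?_)
  have hi' : i ≤ n := Nat.lt_succ_iff.1 (Finset.mem_range.1 hi)
  rw [norm_div, norm_mul, norm_pow, norm_pow, div_div,
    div_le_div_iff₀ (by positivity) (by positivity), mul_assoc]
  refine mul_le_mul_of_nonneg_left ?_ (norm_nonneg _)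
  rw [show n + 1 = i + (n - i) + 1 by omega, pow_add, pow_add, pow_one, mul_assoc]
  gcongr

theorem norm_blaschke_factor_le {r : ℝ} (hr : r < 1) {w : ℂ} (hw : w ∈ halfPlane r) (m : ℕ) :
    ‖(w - 1) ^ m / (w + 1 - 2 * r) ^ m‖ ≤ 1 := by
  have hwp := norm_sub_one_le hr hw
  rw [← div_pow, norm_pow, norm_div]
  exact pow_le_one₀ (by positivity) (div_le_one_of_le₀ hwp (norm_nonneg _))

/-- `h` is dominated by the Laplace transform of `ψ (e ^ v)`, up to a rational function in `H²`. -/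
theorem exists_norm_h_le {a : ℕ → ℂ} {L : ℂ → ℂ} {φ : ℝ → ℂ} {σ₀ r₀ r : ℝ} {m : ℕ}
    (hL : IsDirichletContinuation a L σ₀ m) (hφ : IsWeight φ σ₀) (hσr₀ : σ₀ < r₀)
    (hr₀ : PsiCondition a L φ r₀) (hr₀r : r₀ ≤ r) (hr : r < 1) (A : Seq) :
    ∃ K : ℝ, 0 ≤ K ∧ ∀ s ∈ halfPlane σ₀, ‖h L φ σ₀ m A r s‖ ≤
      K * (‖laplace (logPsi a L φ) (s + r - σ₀)‖ + ‖(s + r - σ₀ + 1 - 2 * r : ℂ)‖⁻¹) := by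
  obtain ⟨n, rfl⟩ : ∃ n, m = n + 1 := ⟨m - 1, (Nat.sub_add_cancel hL.pole_pos).symm⟩
  obtain ⟨N, hN, hNL⟩ := hL.exists_regular
  have hm := aestronglyMeasurable_logPsi (a := a) hφ hL.sigma_lt_one hN hNL
  have hψ := memLp_logPsi hr₀ hm
  set t : ℕ → ℂ := fun i => iteratedDeriv i (fun z => N z * mellin φ z) 1 / i.factorial with ht
  set K₁ : ℝ := ∑ i ∈ Finset.range (n + 1), ‖t i‖ / (1 - r) ^ (n - i) with hK₁
  set K₂ : ℝ := ∑ j, ‖A.c j‖ * A.α j ^ r with hK₂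
  set c : ℂ := -(1 / (Real.sqrt (2 * Real.pi) : ℂ)) with hc
  have hD : 0 < 1 - r := by linarith
  have hK₁0 : 0 ≤ K₁ := Finset.sum_nonneg fun i _ => by positivity
  have hK₂0 : 0 ≤ K₂ := Finset.sum_nonneg fun j _ =>
    mul_nonneg (norm_nonneg _) (Real.rpow_nonneg (A.α_mem j).1.le _)
  refine ⟨‖c‖ * (K₁ + 1) * K₂, by positivity, fun s hs => ?_⟩
  have hw : s + r - σ₀ ∈ halfPlane r := shift_mem_halfPlane hs
  rw [h_eq A hφ (hσr₀.trans_le hr₀r) hr hN hNL hs]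
  set w : ℂ := s + r - σ₀ with hwdef
  have hw' : r < w.re := hw
  rw [regular_eq_taylor_sub_laplace hL hφ hσr₀ hr₀.1 hN hNL hψ (show w ∈ halfPlane r₀ from
    hr₀r.trans_lt hw'), sub_div, norm_mul, norm_mul]
  have h1 := norm_taylor_div_le hr t n hw
  have h2 : ‖(w - 1) ^ (n + 1) * laplace (logPsi a L φ) w / (w + 1 - 2 * r) ^ (n + 1)‖ ≤
      ‖laplace (logPsi a L φ) w‖ := by
    rw [mul_div_right_comm, norm_mul]
    exact mul_le_of_le_one_left (norm_nonneg _) (norm_blaschke_factor_le hr hw _)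
  have h3 := A.norm_g_le hw'.le
  have h4 := (norm_sub_le _ _).trans (add_le_add h1 h2)
  calc _ ≤ ‖c‖ * (K₁ / ‖w + 1 - 2 * r‖ + ‖laplace (logPsi a L φ) w‖) * K₂ := by gcongr
    _ ≤ ‖c‖ * ((K₁ + 1) * (‖laplace (logPsi a L φ) w‖ + ‖w + 1 - 2 * r‖⁻¹)) * K₂ := by
      have h5 : 0 ≤ ‖w + 1 - 2 * r‖⁻¹ := by positivity
      have h6 : 0 ≤ K₁ * ‖laplace (logPsi a L φ) w‖ := by positivity
      gcongr
      rw [div_eq_mul_inv]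
      linarith
    _ = _ := by ring

/-- By Plancherel's theorem for the Laplace transform of `ψ (e ^ v)`, the function `h` is
in `H²`. -/
theorem isTameHardy_h {a : ℕ → ℂ} {L : ℂ → ℂ} {φ : ℝ → ℂ} {σ₀ r₀ r : ℝ} {m : ℕ}
    (hL : IsDirichletContinuation a L σ₀ m) (hφ : IsWeight φ σ₀) (hσr₀ : σ₀ < r₀)
    (hr₀ : PsiCondition a L φ r₀) (hr₀r : r₀ ≤ r) (hr : r < 1) (A : Seq) :
    IsTameHardy σ₀ (h L φ σ₀ m A r) := by
  obtain ⟨n, rfl⟩ : ∃ n, m = n + 1 := ⟨m - 1, (Nat.sub_add_cancel hL.pole_pos).symm⟩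
  obtain ⟨K, hK0, hK⟩ := exists_norm_h_le hL hφ hσr₀ hr₀ hr₀r hr A
  obtain ⟨N, hN, hNL⟩ := hL.exists_regular
  have hm := aestronglyMeasurable_logPsi (a := a) hφ hL.sigma_lt_one hN hNL
  have hψ := memLp_logPsi hr₀ hm
  have hz : ∀ v ≤ 0, logPsi a L φ v = 0 := fun v hv => logPsi_eq_zero a L φ hv
  have hD : 0 < 1 - r := by linarith
  have hσr := hσr₀.trans_le hr₀r
  refine ⟨⟨?_, ?_⟩, fun x hx => ?_⟩
  · refine DifferentiableOn.analyticOnNhd ?_ (isOpen_halfPlane σ₀)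
    exact (differentiableOn_regular_formula A hφ hσr hr hN).congr
      fun s hs => h_eq A hφ hσr hr hN hNL hs
  · set P : ℝ≥0∞ := ENNReal.ofReal (2 * Real.pi) *
      ∫⁻ v : ℝ, ‖cexp (-r₀ * v) * logPsi a L φ v‖ₑ ^ 2
    set Q : ℝ≥0∞ := ∫⁻ t : ℝ, ENNReal.ofReal (2 * (1 - r) / ((1 - r) ^ 2 + (t - 0) ^ 2))
    have hPfin : P < ∞ := by
      refine ENNReal.mul_lt_top ENNReal.ofReal_lt_top ?_
      have := hψ.2
      rw [eLpNorm_lt_top_iff_lintegral_rpow_enorm_lt_top two_ne_zero ENNReal.ofNat_ne_top] at this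
      simpa using this
    have hQfin : Q < ∞ := (integral_poisson hD 0).1.lintegral_lt_top
    set B : ℝ≥0∞ := ENNReal.ofReal (2 * K ^ 2) *
      (P + ENNReal.ofReal (2 * (1 - r))⁻¹ * Q) with hB
    have hBfin : B < ∞ := ENNReal.mul_lt_top ENNReal.ofReal_lt_top
      (ENNReal.add_lt_top.2 ⟨hPfin, ENNReal.mul_lt_top ENNReal.ofReal_lt_top hQfin⟩)
    refine lt_of_le_of_lt (b := B ^ (1 / 2 : ℝ)) (iSup₂_le fun x hx => ?_)
      (ENNReal.rpow_lt_top_of_nonneg (by norm_num) hBfin.ne)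
    refine ENNReal.rpow_le_rpow ?_ (by norm_num)
    have hpt : ∀ t : ℝ, ‖h L φ σ₀ (n + 1) A r (x + t * I)‖ₑ ^ 2 ≤ ENNReal.ofReal (2 * K ^ 2) *
        (‖laplace (logPsi a L φ) (((x + r - σ₀ : ℝ) : ℂ) + t * I)‖ₑ ^ 2 +
          ENNReal.ofReal (2 * (1 - r))⁻¹ *
            ENNReal.ofReal (2 * (1 - r) / ((1 - r) ^ 2 + (t - 0) ^ 2))) := by
      intro t
      have h1 := hK (x + t * I) (by simpa [halfPlane] using hx)
      have ew : (x + t * I + r - σ₀ : ℂ) = ((x + r - σ₀ : ℝ) : ℂ) + t * I := by push_cast; ring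
      rw [ew] at h1
      set w : ℂ := ((x + r - σ₀ : ℝ) : ℂ) + t * I with hw
      have h2 : (‖w + 1 - 2 * r‖⁻¹) ^ 2 ≤
          (2 * (1 - r))⁻¹ * (2 * (1 - r) / ((1 - r) ^ 2 + (t - 0) ^ 2)) := by
        rw [← mul_div_assoc, inv_mul_cancel₀ (by positivity), inv_pow, ← normSq_eq_norm_sq,
          normSq_apply, inv_eq_one_div]
        have hre : (w + 1 - 2 * r : ℂ).re = (x - σ₀) + (1 - r) := by simp [hw]; ring
        have him : (w + 1 - 2 * r : ℂ).im = t := by simp [hw]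
        rw [hre, him]
        have h5 : 0 < x - σ₀ := by linarith
        have h6 : 0 < (1 - r) ^ 2 + (t - 0) ^ 2 := by positivity
        refine one_div_le_one_div_of_le h6 ?_
        nlinarith
      have h3 : ‖h L φ σ₀ (n + 1) A r (x + t * I)‖ ^ 2 ≤ 2 * K ^ 2 *
          (‖laplace (logPsi a L φ) w‖ ^ 2 +
            (2 * (1 - r))⁻¹ * (2 * (1 - r) / ((1 - r) ^ 2 + (t - 0) ^ 2))) := by
        calc _ ≤ (K * (‖laplace (logPsi a L φ) w‖ + ‖w + 1 - 2 * r‖⁻¹)) ^ 2 := by gcongr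
          _ ≤ 2 * K ^ 2 * (‖laplace (logPsi a L φ) w‖ ^ 2 + (‖w + 1 - 2 * r‖⁻¹) ^ 2) := by
            have := mul_le_mul_of_nonneg_left (add_sq_le (a := ‖laplace (logPsi a L φ) w‖)
              (b := ‖w + 1 - 2 * r‖⁻¹)) (sq_nonneg K)
            rw [mul_pow]
            linarith
          _ ≤ _ := by gcongr
      have h4 := ENNReal.ofReal_le_ofReal h3
      rwa [ENNReal.ofReal_mul (p := 2 * K ^ 2) (by positivity),
        ENNReal.ofReal_add (by positivity) (by positivity),
        ENNReal.ofReal_mul (p := (2 * (1 - r))⁻¹) (by positivity),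
        ENNReal.ofReal_pow (norm_nonneg _),
        ENNReal.ofReal_pow (norm_nonneg _), ofReal_norm, ofReal_norm] at h4
    refine (lintegral_mono hpt).trans ?_
    rw [lintegral_const_mul' _ _ ENNReal.ofReal_ne_top, hB]
    gcongr
    rw [lintegral_add_right' _ (by fun_prop), lintegral_const_mul' _ _ ENNReal.ofReal_ne_top]
    gcongr
    exact lintegral_enorm_laplace_sq_le hm hz hψ (by linarith)
  · have hI := integrable_exp_mul_of_sq hm hz hψ (show r₀ < x + r - σ₀ by linarith)
    refine Asymptotics.IsBigO.of_bound (K * ((∫ v : ℝ,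
      ‖cexp (-((x + r - σ₀ : ℝ) : ℂ) * v) * logPsi a L φ v‖) + (1 - r)⁻¹)) ?_
    refine Filter.Eventually.filter_mono inf_le_right (eventually_principal.2 fun s hs => ?_)
    have hs' : x ≤ s.re := hs
    refine (hK s (hx.trans_le hs')).trans ?_
    rw [norm_one, mul_one]
    gcongr
    · refine norm_laplace_le hI (fun v hv => hz v hv.le) ?_
      simp only [sub_re, add_re, ofReal_re]
      linarith
    · refine le_trans ?_ (re_le_norm _)
      simp
      linarith

end ZeroFree

/-- The point `1` is a pole of `L`, hence not a zero; everywhere else in the translated disc the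
value of `L` is nonzero. -/
theorem proposition5p1 (a : ℕ → ℂ) (L : ℂ → ℂ) (σ₀ : ℝ) (m : ℕ)
    (hL : ZeroFree.IsDirichletContinuation a L σ₀ m)
    (φ : ℝ → ℂ) (hφ : ZeroFree.IsWeight φ σ₀)
    (r₀ : ℝ) (hσr₀ : σ₀ < r₀) (hr₀ : ZeroFree.PsiCondition a L φ r₀)
    (r : ℝ) (hr₀r : r₀ ≤ r) (hr : r < 1)
    (lam : ℂ) (hlam : lam ∈ ZeroFree.halfPlane σ₀) (A : ZeroFree.Seq) :
    ZeroFree.MemHardy σ₀ (ZeroFree.h L φ σ₀ m A r) ∧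
    ∀ μ ∈ ZeroFree.disc σ₀ lam
        (Real.sqrt (4 * Real.pi * (lam.re - σ₀))
          * (‖ZeroFree.h L φ σ₀ m A r lam‖ / ZeroFree.hardyNorm σ₀ (ZeroFree.h L φ σ₀ m A r))),
      (r : ℂ) - σ₀ + μ ∈ ZeroFree.halfPlane σ₀ ∧
      ((r : ℂ) - σ₀ + μ ≠ 1 → L ((r : ℂ) - σ₀ + μ) ≠ 0) := by
  have hh := ZeroFree.isTameHardy_h hL hφ hσr₀ hr₀ hr₀r hr A
  refine ⟨hh.memHardy, fun μ hμ => ?_⟩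
  obtain ⟨hμre, hμne⟩ := hh.ne_zero_of_mem_disc hlam hμ
  have hσr := hσr₀.trans_le hr₀r
  refine ⟨?_, fun h1 hL0 => hμne ?_⟩
  · simp only [ZeroFree.halfPlane, Set.mem_ofPred_eq, add_re, sub_re, ofReal_re]
    linarith
  · have hw : (μ + r - σ₀ : ℂ) = (r : ℂ) - σ₀ + μ := by ring
    have hne : μ ≠ 1 - r + σ₀ := fun h => h1 (by rw [h]; ring)
    rw [ZeroFree.h, Function.update_of_ne hne, ZeroFree.hFormula, hw, hL0]
    simp
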